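/- **Notation.** All lattices are finite and are counted up to isomorphism; $x\prec y$ means that $y$ covers $x$. In a lattice, an element $a$ is *reducible* if there are $b,c\neq a$ with $b\wedge c=a$ or $b\vee c=a$. A *(maximal) block* is a finite lattice whose greatest element is the join, and whose least element is the meet, of two elements different from it. The *nullity* of a finite poset is the number of edges minus the number of vertices plus the number of connected components of its cover graph. In a poset $P$, let $\mathrm{Irr}(P)$ be the set of elements with at most one lower cover and at most one upper cover, $\mathrm{Irr}^*(P)$ the set of elements with exactly one lower cover and exactly one upper cover, and $\mathrm{Red}(P)=P\setminus \mathrm{Irr}(P)$. An element $x\in \mathrm{Irr}(P)$ is *retractible* if either there are no $y,z\in \mathrm{Red}(P)$ with $y\prec x\prec z$, or there are $y,z\in \mathrm{Red}(P)$ with $y\prec x\prec z$ and $y\prec x\prec z$ is the only directed path (sequence of elements, each covered by the next) from $y$ to $z$. A *basic retract associated to $P$* is a subposet of $P$, obtained by successively removing retractible elements of $\mathrm{Irr}^*$ (computed in the current subposet), in which no element of $\mathrm{Irr}^*$ is retractible. The *basic block associated to $P$* is obtained from it by successively removing all pendant vertices (vertices of degree one in the cover graph). Let $B_5$ be the $8$-element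 lattice consisting of a chain $0\prec a\prec x\prec b\prec 1$ together with an element $c_1$ with $a\prec c_1\prec b$ and two elements $c_2,c_3$ with $0\prec c_2\prec 1$ and $0\prec c_3\prec 1$. Let $\mathbb{B}_5(j;4,3)$ be the class of all non-isomorphic maximal blocks on $j$ elements that have exactly four reducible elements, these being pairwise comparable, that have nullity three, and whose associated basic block is (isomorphic to) $B_5$. Let $P_n^k$ denote the number of partitions of $n$ into $k$ positive integer parts. **Proposition.** For every integer $j\geq 8$, $$|\mathbb{B}_5(j;4,3)|=\sum_{p=4}^{j-4}\ \sum_{t=1}^{j-p-3} t\,P^2_{j-p-t-1}\,P^2_{p-2}.$$ -/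

import Mathlib

namespace RCLattice

/-! ### Reducible elements, nullity and blocks of lattices -/

section LatticeNotions

/-- `a` is the infimum of two elements, both distinct from `a`. -/
def MeetReducible {α : Type*} [Lattice α] (a : α) : Prop :=
  ∃ b c : α, b ≠ a ∧ c ≠ a ∧ b ⊓ c = a

/-- `a` is the supremum of two elements, both distinct from `a`. -/
def JoinReducible {α : Type*} [Lattice α] (a : α) : Prop :=
  ∃ b c : α, b ≠ a ∧ c ≠ a ∧ b ⊔ c = a

/-- The set of reducible elements of a lattice. -/
def reducibles (α : Type*) [Lattice α] : Set α :=
  {a | MeetReducible a ∨ JoinReducible a}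

/-- A block: a finite lattice whose largest element is join-reducible and whose least element is
meet-reducible. -/
def IsBlock (α : Type*) [Lattice α] : Prop :=
  Finite α ∧ (∃ t : α, IsTop t ∧ JoinReducible t) ∧ (∃ b : α, IsBot b ∧ MeetReducible b)

end LatticeNotions

/-- The nullity of a (finite) poset: number of edges minus number of vertices plus number of
connected components of its cover graph. -/
noncomputable def nullity (P : Type*) [PartialOrder P] : ℤ :=
  ((SimpleGraph.hasse P).edgeSet.ncard : ℤ) - (Nat.card P : ℤ)
    + (Nat.card (SimpleGraph.hasse P).ConnectedComponent : ℤ)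

/-! ### Basic retracts and basic blocks of posets -/

section PosetNotions

/-- Doubly irreducible elements of a poset: at most one lower cover and at most one upper cover. -/
def Irr (P : Type*) [PartialOrder P] : Set P :=
  {x | {y : P | y ⋖ x}.Subsingleton ∧ {z : P | x ⋖ z}.Subsingleton}

/-- Elements of a poset that are not doubly irreducible. -/
def Red (P : Type*) [PartialOrder P] : Set P := (Irr P)ᶜ

/-- Doubly irreducible elements with exactly one lower cover and exactly one upper cover. -/
def IrrStar (P : Type*) [PartialOrder P] : Set P :=
  {x | (∃! y : P, y ⋖ x) ∧ (∃! z : P, x ⋖ z)}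

/-- `l` is a directed path from `y` to `z` in the cover graph of `P`: a list of elements, each
covered by the next, that starts with `y` and ends with `z`. -/
def IsDirectedPath {P : Type*} [PartialOrder P] (y z : P) (l : List P) : Prop :=
  l.IsChain (· ⋖ ·) ∧ l.head? = some y ∧ l.getLast? = some z

/-- Retractible elements of a poset. -/
def Retractible {P : Type*} [PartialOrder P] (x : P) : Prop :=
  x ∈ Irr P ∧
    ((¬ ∃ y ∈ Red P, ∃ z ∈ Red P, y ⋖ x ∧ x ⋖ z) ∨
     (∃ y ∈ Red P, ∃ z ∈ Red P, y ⋖ x ∧ x ⋖ z ∧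
        ∀ l : List P, IsDirectedPath y z l → l = [y, x, z]))

/-- A basic retract: a poset in which no element of `IrrStar` is retractible. -/
def IsBasicRetract (P : Type*) [PartialOrder P] : Prop :=
  ∀ x ∈ IrrStar P, ¬ Retractible x

/-- `x` is a pendant vertex of `P`: it has degree one in the cover graph. -/
def IsPendant {P : Type*} [PartialOrder P] (x : P) : Prop :=
  ((SimpleGraph.hasse P).neighborSet x).ncard = 1

/-- `T` arises from the subposet `S` of `P` by removing one element of `IrrStar S` that is
retractible in `S`. All notions are those of the poset `S` with the induced order. -/
def RetractStep {P : Type*} [PartialOrder P] (S T : Set P) : Prop :=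
  ∃ x : S, x ∈ IrrStar S ∧ Retractible x ∧ T = S \ {(x : P)}

/-- `T` arises from the subposet `S` of `P` by removing one pendant vertex of `S`. -/
def PendantStep {P : Type*} [PartialOrder P] (S T : Set P) : Prop :=
  ∃ x : S, IsPendant x ∧ T = S \ {(x : P)}

/-- `R` is a basic retract associated to `P`: a basic retract obtained from `P` by successive
removal of retractible elements having exactly one lower and exactly one upper cover. -/
def IsBasicRetractOf {P : Type*} [PartialOrder P] (R : Set P) : Prop :=
  Relation.ReflTransGen RetractStep Set.univ R ∧ IsBasicRetract R

/-- `B` is a basic block associated to `P`: it is obtained from a basic retract associated to `P`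
by successive removal of all the pendant vertices. -/
def IsBasicBlockOf {P : Type*} [PartialOrder P] (B : Set P) : Prop :=
  ∃ R : Set P, IsBasicRetractOf R ∧ Relation.ReflTransGen PendantStep R B ∧
    ∀ x : B, ¬ IsPendant x

end PosetNotions

/-! ### The eight-element basic block `B₅` -/

/-- The elements of `B₅`: the chain `zero < a < x < b < one`, an element `c₁` between `a` and `b`,
and elements `c₂`, `c₃` between `zero` and `one`. -/
inductive B5 : Type
  | zero | a | x | b | one | c₁ | c₂ | c₃
  deriving DecidableEq

instance : Fintype B5 where
  elems := {.zero, .a, .x, .b, .one, .c₁, .c₂, .c₃}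
  complete := by intro u; cases u <;> decide

/-- The order of `B₅`: `zero` is least, `one` is greatest, `a < x < b`, `a < c₁ < b`, and there are
no further relations. -/
instance : LE B5 where
  le u v := u = v ∨ u = .zero ∨ v = .one ∨
    (u = .a ∧ (v = .x ∨ v = .c₁ ∨ v = .b)) ∨ (v = .b ∧ (u = .x ∨ u = .c₁))

instance : DecidableLE B5 := fun u v =>
  inferInstanceAs (Decidable (u = v ∨ u = .zero ∨ v = .one ∨
    (u = .a ∧ (v = .x ∨ v = .c₁ ∨ v = .b)) ∨ (v = .b ∧ (u = .x ∨ u = .c₁))))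

instance : PartialOrder B5 where
  le_refl := by decide
  le_trans := by decide
  le_antisymm := by decide

/-! ### The classes to be counted -/

/-- A block with exactly `r` reducible elements, which are pairwise comparable, and of
nullity `k`. -/
def IsBlockOfType (r : ℕ) (k : ℤ) (α : Type*) [Lattice α] : Prop :=
  IsBlock α ∧ (reducibles α).ncard = r ∧ IsChain (· ≤ ·) (reducibles α) ∧ nullity α = k

/-- The poset `Q` is (isomorphic to) the basic block associated to `P`. -/
def HasBasicBlock (P Q : Type*) [PartialOrder P] [PartialOrder Q] : Prop :=
  ∃ B : Set P, IsBasicBlockOf B ∧ Nonempty (B ≃o Q)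

/-- Isomorphism of lattice structures on `Fin j`. -/
def latticeIso (j : ℕ) : Setoid (Lattice (Fin j)) where
  r L M := Nonempty (@OrderIso (Fin j) (Fin j) L.toLE M.toLE)
  iseqv := {
    refl := fun L => ⟨@OrderIso.refl (Fin j) L.toLE⟩
    symm := fun {L M} ⟨e⟩ => ⟨@OrderIso.symm (Fin j) (Fin j) L.toLE M.toLE e⟩
    trans := fun {L M N} ⟨e⟩ ⟨f⟩ =>
      ⟨@OrderIso.trans (Fin j) (Fin j) (Fin j) L.toLE M.toLE N.toLE e f⟩ }

/-- Blocks with four comparable reducible elements and nullity three whose associated basic block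
is `B₅`. -/
def IsBlockB5 (α : Type*) [Lattice α] : Prop :=
  IsBlockOfType 4 3 α ∧ HasBasicBlock α B5

/-- The isomorphism classes of maximal blocks on `j` elements that have four comparable reducible
elements and nullity three and whose associated basic block is `B₅`. The lattice structure on
`Fin j` is an arbitrary one, `L`, not the usual linear order. -/
def blocksB5 (j : ℕ) : Set (Quotient (latticeIso j)) :=
  {q | ∃ L : Lattice (Fin j), Quotient.mk (latticeIso j) L = q ∧ @IsBlockB5 (Fin j) L}

/-- The number of partitions of `n` into `k` positive parts. -/
def numPartitions (n k : ℕ) : ℕ :=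
  Fintype.card {p : n.Partition // p.parts.card = k}

end RCLattice

/-! The counted lattices are exactly the lexicographic sums over `B5` of nonempty finite chains in
which the chains over `zero` and `one` are singletons (`isBlockB5_iff`); a map `π` to `B5` with such
fibres is a `B5Fib`. The count then becomes a count of chain lengths.

To reach this form, "retractible and in `IrrStar`" is rewritten as a local condition, `Slack`: `x`
has a unique lower cover `y`, a unique upper cover `z`, and is alone strictly between them. Removing
such an `x` replaces the edges `y ⋖ x ⋖ z` by `y ⋖ z`, so edges minus vertices is preserved, and so
is having minimum degree two. A block has minimum degree two, hence so does every retract, and the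
removal of pendant vertices never does anything.

If the basic block is `B5`, the removed elements are put back one at a time. Each subdivides a
covering pair, and every covering pair of `B5` has an end, other than `zero` and `one`, whose chain
can absorb the new element (`B5Fib.exists_of_slack`). Conversely, a fibration that is not injective
always contains a slack element whose removal leaves a fibration (`B5Fib.exists_slack`), so it
retracts to a copy of `B5`; nullity and reducible elements are read off from the fibration.

Chain lengths determine the lattice up to isomorphism. They can be recovered from it up to
exchanging `x` with `c₁` and `c₂` with `c₃` (`HasFibreSizes.compare`), because the top of the chain
over `a` and the bottom of the chain over `b` are recognisable in the order alone. Normalising by `x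
≤ c₁` and `c₂ ≤ c₃` gives one length vector per class. With `p = c₂ + c₃ + 2` and `t + 1 = a + b`,
there are `t` choices for the lengths over `a` and `b`, and each unordered pair is a partition into
two parts. -/

namespace RCLattice

/-! ### Retractibility as a local order condition -/

section Slack

variable {P : Type*} [PartialOrder P]

/-- In the subposet `S`, the element `x` subdivides what is a covering pair `y ⋖ z` of
`S \ {x}`. -/
structure Slack (S : Set P) (x y z : P) : Prop where
  mem : x ∈ S
  mem_lower : y ∈ S
  mem_upper : z ∈ S
  lower_lt : y < x
  lt_upper : x < z
  le_lower : ∀ u ∈ S, u < x → u ≤ y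
  upper_le : ∀ u ∈ S, x < u → z ≤ u
  eq_of_between : ∀ u ∈ S, y < u → u < z → u = x

theorem Slack.lower_covBy {x y z : P} (h : Slack Set.univ x y z) : y ⋖ x :=
  ⟨h.lower_lt, fun u hu hux => (h.le_lower u trivial hux).not_gt hu⟩

theorem Slack.covBy_upper {x y z : P} (h : Slack Set.univ x y z) : x ⋖ z :=
  ⟨h.lt_upper, fun u hu huz => (h.upper_le u trivial hu).not_gt huz⟩

theorem Slack.eq_lower {x y z u : P} (h : Slack Set.univ x y z) (hu : u ⋖ x) : u = y := by
  by_contra hne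
  exact hu.2 (lt_of_le_of_ne (h.le_lower u trivial hu.1) hne) h.lower_lt

theorem Slack.eq_upper {x y z u : P} (h : Slack Set.univ x y z) (hu : x ⋖ u) : u = z := by
  by_contra hne
  exact hu.2 h.lt_upper (lt_of_le_of_ne (h.upper_le u trivial hu.1) (Ne.symm hne))

theorem IsDirectedPath.le {y z : P} {l : List P} (h : IsDirectedPath y z l) : y ≤ z := by
  induction l generalizing y with
  | nil => simp [IsDirectedPath] at h
  | cons a l ih =>
    obtain ⟨hc, hh, hl⟩ := h
    simp only [List.head?_cons, Option.some.injEq] at hh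
    subst hh
    cases l with
    | nil => simp at hl; exact hl.le
    | cons b l =>
      rw [List.isChain_cons_cons] at hc
      exact hc.1.le.trans (ih ⟨hc.2, rfl, by simpa using hl⟩)

theorem IsDirectedPath.tail {y z b : P} {l : List P} (h : IsDirectedPath y z (y :: b :: l)) :
    y ⋖ b ∧ IsDirectedPath b z (b :: l) := by
  obtain ⟨hc, -, hl⟩ := h
  rw [List.isChain_cons_cons] at hc
  exact ⟨hc.1, hc.2, rfl, by simpa using hl⟩

theorem exists_isDirectedPath [Finite P] {y z : P} (h : y ≤ z) :
    ∃ l : List P, IsDirectedPath y z (y :: l) := by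
  induction y using WellFoundedGT.induction with
  | ind y ih =>
    rcases h.eq_or_lt with rfl | hlt
    · exact ⟨[], by simp [IsDirectedPath]⟩
    · obtain ⟨w, hyw, hwz⟩ := exists_covBy_le_of_lt hlt
      obtain ⟨l, hl⟩ := ih w hyw.1 hwz
      refine ⟨w :: l, ?_, rfl, ?_⟩
      · exact List.isChain_cons_cons.2 ⟨hyw, hl.1⟩
      · simpa using hl.2.2

theorem Slack.eq_path {x y z : P} (h : Slack Set.univ x y z) {l : List P}
    (hl : IsDirectedPath y z l) : l = [y, x, z] := by
  have hyz : y < z := h.lower_lt.trans h.lt_upper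
  match l, hl with
  | [], hl => simp [IsDirectedPath] at hl
  | [a], hl =>
    simp only [IsDirectedPath, List.head?_cons, List.getLast?_singleton, Option.some.injEq] at hl
    exact absurd (hl.2.1.symm.trans hl.2.2) hyz.ne
  | a :: b :: l, hl =>
    obtain rfl : a = y := by simpa using hl.2.1
    obtain ⟨hab, hb⟩ := hl.tail
    have hbz : b < z := by
      refine lt_of_le_of_ne hb.le ?_
      rintro rfl
      exact hab.2 h.lower_lt h.lt_upper
    obtain rfl := h.eq_of_between b trivial hab.1 hbz
    match l, hb with
    | [], hb =>
      simp only [IsDirectedPath, List.head?_cons, List.getLast?_singleton, Option.some.injEq] at hb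
      exact absurd hb.2.2 hbz.ne
    | c :: l, hb =>
      obtain ⟨hbc, hc⟩ := hb.tail
      obtain rfl := h.eq_upper hbc
      match l, hc with
      | [], _ => rfl
      | d :: l, hc => exact absurd hc.tail.2.le hc.tail.1.1.not_ge

/-- A second element between the two covers `y`, `z` of `x` gives `y` another upper cover and `z`
another lower cover. Both are then in `Red`, and there is a second path from `y` to `z`, so both
alternatives of `Retractible` fail. Conversely, if `x` is alone between them, the path is forced. -/
theorem mem_irrStar_and_retractible_iff [Finite P] {x : P} :
    (x ∈ IrrStar P ∧ Retractible x) ↔ ∃ y z, Slack Set.univ x y z := by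
  constructor
  · rintro ⟨⟨⟨y, hy, hy'⟩, ⟨z, hz, hz'⟩⟩, -, hr⟩
    have hlow : ∀ u, u < x → u ≤ y := fun u hu => by
      obtain ⟨w, huw, hw⟩ := exists_le_covBy_of_lt hu
      exact hy' w hw ▸ huw
    have hupp : ∀ u, x < u → z ≤ u := fun u hu => by
      obtain ⟨w, hw, hwu⟩ := exists_covBy_le_of_lt hu
      exact hz' w hw ▸ hwu
    refine ⟨y, z, trivial, trivial, trivial, hy.1, hz.1, fun u _ => hlow u, fun u _ => hupp u, ?_⟩
    intro u _ hyu huz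
    by_contra hne
    obtain ⟨w, hyw, hwu⟩ := exists_covBy_le_of_lt hyu
    obtain ⟨w', huw', hw'z⟩ := exists_le_covBy_of_lt huz
    have hwx : w ≠ x := by
      rintro rfl
      exact (hupp u (lt_of_le_of_ne hwu (Ne.symm hne))).not_gt huz
    have hw'x : w' ≠ x := by
      rintro rfl
      exact (hlow u (lt_of_le_of_ne huw' hne)).not_gt hyu
    -- The covers `w` of `y` and `w'` below `z` avoid `x`: they put `y` and `z` in `Red`, and a path
    -- starting with `w` contradicts uniqueness.
    rcases hr with hr | ⟨y', -, z', -, hy'x, hxz', hp⟩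
    · refine hr ⟨y, fun hi => hwx (hi.2 hyw hy), z, fun hi => hw'x (hi.1 hw'z hz), hy, hz⟩
    · obtain rfl := hy' y' hy'x
      obtain rfl := hz' z' hxz'
      obtain ⟨l, hl⟩ := exists_isDirectedPath (hwu.trans huz.le)
      have := hp (y' :: w :: l) ⟨List.isChain_cons_cons.2 ⟨hyw, hl.1⟩, rfl, by simpa using hl.2.2⟩
      simp only [List.cons.injEq] at this
      exact hwx this.2.1
  · rintro ⟨y, z, h⟩
    refine ⟨⟨⟨y, h.lower_covBy, fun u => h.eq_lower⟩, ⟨z, h.covBy_upper, fun u => h.eq_upper⟩⟩,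
      ⟨fun u hu v hv => (h.eq_lower hu).trans (h.eq_lower hv).symm,
        fun u hu v hv => (h.eq_upper hu).trans (h.eq_upper hv).symm⟩, ?_⟩
    rw [or_iff_not_imp_left, not_not]
    rintro ⟨y', hy', z', hz', hyx, hxz⟩
    obtain rfl := h.eq_lower hyx
    obtain rfl := h.eq_upper hxz
    exact ⟨y', hy', z', hz', hyx, hxz, fun l => h.eq_path⟩

theorem slack_coe_iff {S : Set P} {x y z : S} :
    Slack Set.univ x y z ↔ Slack S (x : P) y z := by
  constructor
  · intro h
    exact ⟨x.2, y.2, z.2, h.lower_lt, h.lt_upper, fun u hu => h.le_lower ⟨u, hu⟩ trivial,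
      fun u hu => h.upper_le ⟨u, hu⟩ trivial,
      fun u hu h1 h2 => congrArg Subtype.val (h.eq_of_between ⟨u, hu⟩ trivial h1 h2)⟩
  · intro h
    exact ⟨trivial, trivial, trivial, h.lower_lt, h.lt_upper, fun u _ => h.le_lower u u.2,
      fun u _ => h.upper_le u u.2, fun u _ h1 h2 => Subtype.ext (h.eq_of_between u u.2 h1 h2)⟩

theorem retractStep_iff [Finite P] {S T : Set P} :
    RetractStep S T ↔ ∃ x y z, Slack S x y z ∧ T = S \ {x} := by
  constructor
  · rintro ⟨x, h1, h2, rfl⟩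
    obtain ⟨y, z, h⟩ := mem_irrStar_and_retractible_iff.1 ⟨h1, h2⟩
    exact ⟨x, y, z, slack_coe_iff.1 h, rfl⟩
  · rintro ⟨x, y, z, h, rfl⟩
    have := slack_coe_iff (x := ⟨x, h.mem⟩) (y := ⟨y, h.mem_lower⟩) (z := ⟨z, h.mem_upper⟩) |>.2 h
    obtain ⟨h1, h2⟩ := mem_irrStar_and_retractible_iff.2 ⟨_, _, this⟩
    exact ⟨⟨x, h.mem⟩, h1, h2, rfl⟩

theorem isBasicRetract_iff [Finite P] {S : Set P} :
    IsBasicRetract S ↔ ∀ x y z, ¬ Slack S x y z := by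
  constructor
  · intro h x y z hs
    have := slack_coe_iff (x := ⟨x, hs.mem⟩) (y := ⟨y, hs.mem_lower⟩)
      (z := ⟨z, hs.mem_upper⟩) |>.2 hs
    obtain ⟨h1, h2⟩ := mem_irrStar_and_retractible_iff.2 ⟨_, _, this⟩
    exact h _ h1 h2
  · intro h x h1 h2
    obtain ⟨y, z, hs⟩ := mem_irrStar_and_retractible_iff.1 ⟨h1, h2⟩
    exact h _ _ _ (slack_coe_iff.1 hs)

end Slack

end RCLattice
namespace RCLattice

/-! ### Cover graphs of subposets and the effect of one removal -/

section Covers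

variable {P : Type*} [PartialOrder P]

/-- In the subposet `S`, the element `v` covers `u`. -/
def CovByIn (S : Set P) (u v : P) : Prop :=
  u ∈ S ∧ v ∈ S ∧ u < v ∧ ∀ w ∈ S, u < w → ¬ w < v

/-- The set of covering pairs of the subposet `S`. -/
def coverPairs (S : Set P) : Set (P × P) := {p | CovByIn S p.1 p.2}

/-- Adjacency in the cover graph of the subposet `S`. -/
def AdjIn (S : Set P) (u v : P) : Prop := CovByIn S u v ∨ CovByIn S v u

/-- Every element of the subposet `S` has at least two neighbours in its cover graph. -/
def MinDegreeTwo (S : Set P) : Prop :=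
  ∀ v ∈ S, ∃ u w, u ≠ w ∧ AdjIn S v u ∧ AdjIn S v w

theorem covBy_coe_iff {S : Set P} {u v : S} : u ⋖ v ↔ CovByIn S (u : P) v := by
  constructor
  · intro h
    exact ⟨u.2, v.2, h.1, fun w hw h1 h2 => h.2 (c := ⟨w, hw⟩) h1 h2⟩
  · rintro ⟨-, -, h1, h2⟩
    exact ⟨h1, fun w hw hw' => h2 w w.2 hw hw'⟩

theorem covByIn_univ_iff {u v : P} : CovByIn Set.univ u v ↔ u ⋖ v := by
  simp only [CovByIn, CovBy, Set.mem_univ, true_and, true_imp_iff]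

theorem Slack.covByIn_diff_iff {S : Set P} {x y z u v : P} (h : Slack S x y z) :
    CovByIn (S \ {x}) u v ↔ (u ≠ x ∧ v ≠ x ∧ CovByIn S u v) ∨ (u = y ∧ v = z) := by
  constructor
  · rintro ⟨⟨hu, hux⟩, ⟨hv, hvx⟩, huv, hb⟩
    rw [Set.mem_singleton_iff] at hux hvx
    by_cases hx : u < x ∧ x < v
    · right
      have h1 := h.le_lower u hu hx.1
      have h2 := h.upper_le v hv hx.2
      constructor
      · by_contra hne
        exact hb y ⟨h.mem_lower, h.lower_lt.ne⟩ (lt_of_le_of_ne h1 hne)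
          (h.lower_lt.trans hx.2)
      · by_contra hne
        exact hb z ⟨h.mem_upper, h.lt_upper.ne'⟩ (hx.1.trans h.lt_upper)
          (lt_of_le_of_ne h2 (Ne.symm hne))
    · refine Or.inl ⟨hux, hvx, hu, hv, huv, fun w hw h1 h2 => ?_⟩
      by_cases hwx : w = x
      · exact hx ⟨hwx ▸ h1, hwx ▸ h2⟩
      · exact hb w ⟨hw, hwx⟩ h1 h2
  · rintro (⟨hux, hvx, hu, hv, huv, hb⟩ | ⟨rfl, rfl⟩)
    · exact ⟨⟨hu, hux⟩, ⟨hv, hvx⟩, huv, fun w hw => hb w hw.1⟩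
    · exact ⟨⟨h.mem_lower, h.lower_lt.ne⟩, ⟨h.mem_upper, h.lt_upper.ne'⟩,
        h.lower_lt.trans h.lt_upper, fun w hw h1 h2 => hw.2 (h.eq_of_between w hw.1 h1 h2)⟩

theorem Slack.covByIn_left_iff {S : Set P} {x y z u : P} (h : Slack S x y z) :
    CovByIn S u x ↔ u = y := by
  constructor
  · rintro ⟨hu, -, hux, hb⟩
    by_contra hne
    exact hb y h.mem_lower (lt_of_le_of_ne (h.le_lower u hu hux) hne) h.lower_lt
  · rintro rfl
    exact ⟨h.mem_lower, h.mem, h.lower_lt, fun w hw h1 h2 => (h.le_lower w hw h2).not_gt h1⟩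

theorem Slack.covByIn_right_iff {S : Set P} {x y z v : P} (h : Slack S x y z) :
    CovByIn S x v ↔ v = z := by
  constructor
  · rintro ⟨-, hv, hxv, hb⟩
    by_contra hne
    exact hb z h.mem_upper h.lt_upper (lt_of_le_of_ne (h.upper_le v hv hxv) (Ne.symm hne))
  · rintro rfl
    exact ⟨h.mem, h.mem_upper, h.lt_upper, fun w hw h1 h2 => (h.upper_le w hw h1).not_gt h2⟩

theorem Slack.not_covByIn {S : Set P} {x y z : P} (h : Slack S x y z) : ¬ CovByIn S y z :=
  fun hc => hc.2.2.2 x h.mem h.lower_lt h.lt_upper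

theorem Slack.ncard_coverPairs [Finite P] {S : Set P} {x y z : P} (h : Slack S x y z) :
    (coverPairs S).ncard = (coverPairs (S \ {x})).ncard + 1 := by
  -- Two edges disappear and one appears; adding the missing ones to both sides avoids set
  -- differences in the count.
  have key : insert (y, z) (coverPairs S) =
      insert (y, x) (insert (x, z) (coverPairs (S \ {x}))) := by
    ext ⟨u, v⟩
    simp only [coverPairs, Set.mem_insert_iff, Prod.mk.injEq, Set.mem_ofPred_eq,
      h.covByIn_diff_iff]
    by_cases hu : u = x
    · subst hu
      rw [h.covByIn_right_iff]
      have := h.lower_lt.ne'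
      tauto
    · by_cases hv : v = x
      · subst hv
        rw [h.covByIn_left_iff]
        have := h.lt_upper.ne
        tauto
      · tauto
  have hx1 : (x, z) ∉ coverPairs (S \ {x}) := fun hc => hc.1.2 rfl
  have hx2 : (y, x) ∉ insert (x, z) (coverPairs (S \ {x})) := by
    rintro (hc | hc)
    · exact h.lower_lt.ne (Prod.ext_iff.1 hc).1
    · exact hc.2.1.2 rfl
  have hx3 : (y, z) ∉ coverPairs S := h.not_covByIn
  have := congrArg Set.ncard key
  rw [Set.ncard_insert_of_notMem hx3, Set.ncard_insert_of_notMem hx2,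
    Set.ncard_insert_of_notMem hx1] at this
  omega

/-- Only `y` and `z` lose the neighbour `x`, and each gains the other in exchange. They were not
adjacent before, so the gained neighbour differs from the surviving one. -/
theorem Slack.minDegreeTwo_diff {S : Set P} {x y z : P} (h : Slack S x y z)
    (hS : MinDegreeTwo S) : MinDegreeTwo (S \ {x}) := by
  classical
  rintro v ⟨hv, hvx⟩
  rw [Set.mem_singleton_iff] at hvx
  have hyz : y < z := h.lower_lt.trans h.lt_upper
  have hnyz : ¬ AdjIn S y z := by
    rintro (hc | hc)
    · exact h.not_covByIn hc
    · exact hc.2.2.1.not_gt hyz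
  have keep : ∀ n, n ≠ x → AdjIn S v n → AdjIn (S \ {x}) v n := by
    rintro n hn (hc | hc)
    · exact Or.inl (h.covByIn_diff_iff.2 (Or.inl ⟨hvx, hn, hc⟩))
    · exact Or.inr (h.covByIn_diff_iff.2 (Or.inl ⟨hn, hvx, hc⟩))
  have swap : AdjIn S v x → ∃ n, AdjIn (S \ {x}) v n ∧ ¬ AdjIn S v n := by
    rintro (hc | hc)
    · obtain rfl := h.covByIn_left_iff.1 hc
      exact ⟨z, Or.inl (h.covByIn_diff_iff.2 (Or.inr ⟨rfl, rfl⟩)), hnyz⟩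
    · obtain rfl := h.covByIn_right_iff.1 hc
      exact ⟨y, Or.inr (h.covByIn_diff_iff.2 (Or.inr ⟨rfl, rfl⟩)), fun hc => hnyz hc.symm⟩
  obtain ⟨u, w, huw, hu, hw⟩ := hS v hv
  by_cases hux : u = x
  · subst hux
    obtain ⟨n, hn, hn'⟩ := swap hu
    exact ⟨n, w, fun e => hn' (e ▸ hw), hn, keep w huw.symm hw⟩
  · by_cases hwx : w = x
    · subst hwx
      obtain ⟨n, hn, hn'⟩ := swap hw
      exact ⟨u, n, fun e => hn' (e ▸ hu), keep u hux hu, hn⟩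
    · exact ⟨u, w, huw, keep u hux hu, keep w hwx hw⟩

theorem MinDegreeTwo.not_isPendant {S : Set P} (hS : MinDegreeTwo S) (x : S) :
    ¬ IsPendant x := by
  intro hx
  obtain ⟨a, ha⟩ := Set.ncard_eq_one.1 hx
  obtain ⟨u, w, huw, hu, hw⟩ := hS x x.2
  have mem : ∀ n, AdjIn S x n → ∃ hn : n ∈ S, (⟨n, hn⟩ : S) = a := by
    intro n hn
    have hnS : n ∈ S := by
      rcases hn with hn | hn
      · exact hn.2.1
      · exact hn.1
    refine ⟨hnS, ?_⟩
    have : (⟨n, hnS⟩ : S) ∈ (SimpleGraph.hasse S).neighborSet x := by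
      rw [SimpleGraph.mem_neighborSet, SimpleGraph.hasse_adj, covBy_coe_iff, covBy_coe_iff]
      exact hn
    rwa [ha] at this
  obtain ⟨_, h1⟩ := mem u hu
  obtain ⟨_, h2⟩ := mem w hw
  exact huw (congrArg Subtype.val (h1.trans h2.symm))

theorem ncard_edgeSet_hasse : (SimpleGraph.hasse P).edgeSet.ncard =
    (coverPairs (Set.univ : Set P)).ncard := by
  symm
  refine Set.ncard_congr (fun p _ => s(p.1, p.2)) ?_ ?_ ?_
  · rintro ⟨u, v⟩ h
    rw [SimpleGraph.mem_edgeSet, SimpleGraph.hasse_adj]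
    exact Or.inl (covByIn_univ_iff.1 h)
  · rintro ⟨u, v⟩ ⟨u', v'⟩ h h' he
    rcases Sym2.eq_iff.1 he with ⟨h1, h2⟩ | ⟨h1, h2⟩
    · exact Prod.ext h1 h2
    · have hlt : u < v := h.2.2.1
      have hlt' : u' < v' := h'.2.2.1
      simp only at h1 h2
      subst h1 h2
      exact absurd hlt hlt'.not_gt
  · intro e
    induction e with
    | _ u v =>
      intro he
      rw [SimpleGraph.mem_edgeSet, SimpleGraph.hasse_adj] at he
      rcases he with he | he
      · exact ⟨(u, v), covByIn_univ_iff.2 he, rfl⟩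
      · exact ⟨(v, u), covByIn_univ_iff.2 he, Sym2.eq_swap⟩

/-- Descending along covers reaches the least element from anywhere, so the cover graph is
connected. -/
theorem nullity_eq [Finite P] {b : P} (hb : IsBot b) :
    nullity P = ((coverPairs (Set.univ : Set P)).ncard : ℤ) - Nat.card P + 1 := by
  have hreach : ∀ v, (SimpleGraph.hasse P).Reachable b v := by
    intro v
    induction v using WellFoundedLT.induction with
    | ind v ih =>
      rcases (hb v).eq_or_lt with rfl | hlt
      · rfl
      · obtain ⟨w, -, hw⟩ := exists_le_covBy_of_lt hlt
        exact (ih w hw.1).trans (SimpleGraph.Adj.reachable (Or.inl hw))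
  have hpre : (SimpleGraph.hasse P).Preconnected := fun u v => (hreach u).symm.trans (hreach v)
  have hsub := hpre.subsingleton_connectedComponent
  have : Nat.card (SimpleGraph.hasse P).ConnectedComponent = 1 := by
    rw [Nat.card_eq_one_iff_unique]
    exact ⟨hsub, ⟨(SimpleGraph.hasse P).connectedComponentMk b⟩⟩
  rw [nullity, this, ncard_edgeSet_hasse, Nat.cast_one]

end Covers

/-! ### Pendant vertices never occur -/

section BlockDegrees

/-- Reducibility provides two covers at the bottom and two at the top; any other element has a
neighbour on each side. -/
theorem IsBlock.minDegreeTwo {α : Type*} [Lattice α] (h : IsBlock α) :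
    MinDegreeTwo (Set.univ : Set α) := by
  obtain ⟨hfin, ⟨t, ht, p, q, hp, hq, hpq⟩, ⟨b, hb, r, s, hr, hs, hrs⟩⟩ := h
  intro v _
  simp only [AdjIn, covByIn_univ_iff]
  by_cases hvb : v = b
  · subst hvb
    obtain ⟨u, hu, hur⟩ := exists_covBy_le_of_lt (lt_of_le_of_ne (hb r) hr.symm)
    obtain ⟨w, hw, hws⟩ := exists_covBy_le_of_lt (lt_of_le_of_ne (hb s) hs.symm)
    refine ⟨u, w, ?_, Or.inl hu, Or.inl hw⟩
    rintro rfl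
    exact hu.1.not_ge (hrs ▸ le_inf hur hws)
  · by_cases hvt : v = t
    · subst hvt
      obtain ⟨u, hur, hu⟩ := exists_le_covBy_of_lt (lt_of_le_of_ne (ht p) hp)
      obtain ⟨w, hws, hw⟩ := exists_le_covBy_of_lt (lt_of_le_of_ne (ht q) hq)
      refine ⟨u, w, ?_, Or.inr hu, Or.inr hw⟩
      rintro rfl
      exact hu.1.not_ge (hpq ▸ sup_le hur hws)
    · obtain ⟨u, -, hu⟩ := exists_le_covBy_of_lt (lt_of_le_of_ne (hb v) (Ne.symm hvb))
      obtain ⟨w, hw, -⟩ := exists_covBy_le_of_lt (lt_of_le_of_ne (ht v) hvt)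
      exact ⟨u, w, (hu.1.trans hw.1).ne, Or.inr hu, Or.inl hw⟩

theorem reflTransGen_pendantStep_eq {P : Type*} [PartialOrder P] {R B : Set P}
    (hR : MinDegreeTwo R) (h : Relation.ReflTransGen PendantStep R B) : B = R := by
  rcases h.cases_head with rfl | ⟨T, ⟨x, hx, -⟩, -⟩
  · rfl
  · exact absurd hx (hR.not_isPendant x)

theorem minDegreeTwo_of_reflTransGen {P : Type*} [PartialOrder P] [Finite P] {S R : Set P}
    (hS : MinDegreeTwo S) (h : Relation.ReflTransGen RetractStep S R) : MinDegreeTwo R := by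
  induction h with
  | refl => exact hS
  | tail _ hstep ih =>
    obtain ⟨x, y, z, hs, rfl⟩ := retractStep_iff.1 hstep
    exact hs.minDegreeTwo_diff ih

end BlockDegrees

end RCLattice
namespace RCLattice

/-! ### Lexicographic sums of chains and reinsertion of an element -/

section ChainFibrations

variable {P Q : Type*} [PartialOrder P] [PartialOrder Q]

/-- `π` exhibits the subposet `S` as a lexicographic sum, indexed by `Q`, of nonempty chains. -/
structure ChainFib (S : Set P) (π : P → Q) : Prop where
  surj : ∀ q, ∃ u ∈ S, π u = q
  lt : ∀ u ∈ S, ∀ v ∈ S, π u < π v → u < v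
  mono : ∀ u ∈ S, ∀ v ∈ S, u ≤ v → π u ≤ π v
  chain : ∀ u ∈ S, ∀ v ∈ S, π u = π v → u ≤ v ∨ v ≤ u

open OrderDual in
theorem ChainFib.dual {S : Set P} {π : P → Q} (h : ChainFib S π) :
    ChainFib (ofDual ⁻¹' S) (toDual ∘ π ∘ ofDual) where
  surj q := h.surj (ofDual q)
  lt u hu v hv huv := h.lt v hv u hu huv
  mono u hu v hv huv := h.mono v hv u hu huv
  chain u hu v hv huv := h.chain v hv u hu huv.symm

open OrderDual in
theorem Slack.dual {S : Set P} {x y z : P} (h : Slack S x y z) :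
    Slack (ofDual ⁻¹' S) (toDual x) (toDual z) (toDual y) where
  mem := h.mem
  mem_lower := h.mem_upper
  mem_upper := h.mem_lower
  lower_lt := h.lt_upper
  lt_upper := h.lower_lt
  le_lower u hu := h.upper_le u hu
  upper_le u hu := h.le_lower u hu
  eq_of_between u hu h1 h2 := h.eq_of_between u hu h2 h1

/-- The new element `x` joins the chain of `y`. Everything in a later fibre must then lie above `x`,
although `x` is only known to lie below what is above `z`; the hypothesis `hup` guarantees that
later fibres start at or after that of `z`. -/
theorem ChainFib.update_lower [DecidableEq P] {S : Set P} {π : P → Q} {x y z : P}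
    (hs : Slack S x y z) (h : ChainFib (S \ {x}) π) (hup : ∀ q, π y < q → π z ≤ q) :
    ChainFib S (Function.update π x (π y)) := by
  have hy : y ∈ S \ {x} := ⟨hs.mem_lower, hs.lower_lt.ne⟩
  have hz : z ∈ S \ {x} := ⟨hs.mem_upper, hs.lt_upper.ne'⟩
  have hyz : y < z := hs.lower_lt.trans hs.lt_upper
  have hpyz : π y ≤ π z := h.mono y hy z hz hyz.le
  -- Since `x` is alone between `y` and `z`, an element above `y` and comparable with `z` is at
  -- least `z`.
  have above : ∀ u ∈ S \ {x}, y < u → (u ≤ z ∨ z ≤ u) → x < u := by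
    rintro u hu hyu (huz | huz)
    · rcases huz.eq_or_lt with rfl | hlt
      · exact hs.lt_upper
      · exact absurd (hs.eq_of_between u hu.1 hyu hlt) hu.2
    · exact hs.lt_upper.trans_le huz
  have hx : Function.update π x (π y) x = π y := Function.update_self ..
  have hne : ∀ u, u ≠ x → Function.update π x (π y) u = π u :=
    fun u hu => Function.update_of_ne hu ..
  have hlt : ∀ u ∈ S \ {x}, π y < π u → x < u := by
    intro u hu hlt
    refine above u hu (h.lt y hy u hu hlt) ?_
    rcases (hup _ hlt).eq_or_lt with he | hl
    · exact (h.chain z hz u hu he).symm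
    · exact Or.inr (h.lt z hz u hu hl).le
  have hch : ∀ u ∈ S \ {x}, π u = π y → u ≤ x ∨ x ≤ u := by
    intro u hu he
    rcases h.chain u hu y hy he with hle | hle
    · exact Or.inl (hle.trans hs.lower_lt.le)
    · rcases hle.eq_or_lt with rfl | hl
      · exact Or.inl hs.lower_lt.le
      · right
        refine (above u hu hl ?_).le
        rcases (he ▸ hpyz : π u ≤ π z).eq_or_lt with he' | hl'
        · exact h.chain u hu z hz he'
        · exact Or.inl (h.lt u hu z hz hl').le
  refine ⟨fun q => ?_, fun u hu v hv huv => ?_, fun u hu v hv huv => ?_, fun u hu v hv huv => ?_⟩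
  · obtain ⟨u, hu, rfl⟩ := h.surj q
    exact ⟨u, hu.1, hne u hu.2⟩
  · by_cases hux : u = x
    · by_cases hvx : v = x
      · rw [hux, hvx] at huv
        exact absurd huv (lt_irrefl _)
      · rw [hux, hx, hne v hvx] at huv
        exact hux ▸ hlt v ⟨hv, hvx⟩ huv
    · by_cases hvx : v = x
      · rw [hvx, hx, hne u hux] at huv
        exact hvx ▸ (h.lt u ⟨hu, hux⟩ y hy huv).trans hs.lower_lt
      · rw [hne u hux, hne v hvx] at huv
        exact h.lt u ⟨hu, hux⟩ v ⟨hv, hvx⟩ huv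
  · by_cases hux : u = x
    · by_cases hvx : v = x
      · rw [hux, hvx]
      · rw [hux, hx, hne v hvx]
        rw [hux] at huv
        exact hpyz.trans (h.mono z hz v ⟨hv, hvx⟩
          (hs.upper_le v hv (lt_of_le_of_ne huv (Ne.symm hvx))))
    · by_cases hvx : v = x
      · rw [hvx, hx, hne u hux]
        rw [hvx] at huv
        exact h.mono u ⟨hu, hux⟩ y hy (hs.le_lower u hu (lt_of_le_of_ne huv hux))
      · rw [hne u hux, hne v hvx]
        exact h.mono u ⟨hu, hux⟩ v ⟨hv, hvx⟩ huv
  · by_cases hux : u = x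
    · by_cases hvx : v = x
      · rw [hux, hvx]
        exact Or.inl le_rfl
      · rw [hux, hx, hne v hvx] at huv
        exact hux ▸ (hch v ⟨hv, hvx⟩ huv.symm).symm
    · by_cases hvx : v = x
      · rw [hvx, hx, hne u hux] at huv
        exact hvx ▸ hch u ⟨hu, hux⟩ huv
      · rw [hne u hux, hne v hvx] at huv
        exact h.chain u ⟨hu, hux⟩ v ⟨hv, hvx⟩ huv

open OrderDual in
theorem ChainFib.update_upper [DecidableEq P] {S : Set P} {π : P → Q} {x y z : P}
    (hs : Slack S x y z) (h : ChainFib (S \ {x}) π) (hlow : ∀ q, q < π z → q ≤ π y) :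
    ChainFib S (Function.update π x (π z)) := by
  let _ : DecidableEq Pᵒᵈ := inferInstanceAs (DecidableEq P)
  exact (ChainFib.update_lower hs.dual h.dual hlow).dual

end ChainFibrations

/-! ### Reinsertion over `B5` -/

section B5Fibrations

/-- `π` exhibits the subposet `S` as a lexicographic sum of nonempty chains indexed by `B5`, the
chains over `zero` and `one` being singletons. -/
structure B5Fib {P : Type*} [PartialOrder P] (S : Set P) (π : P → B5) : Prop
    extends ChainFib S π where
  zero_unique : ∀ u ∈ S, ∀ v ∈ S, π u = .zero → π v = .zero → u = v
  one_unique : ∀ u ∈ S, ∀ v ∈ S, π u = .one → π v = .one → u = v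

instance : DecidableLT B5 := fun u v =>
  inferInstanceAs (Decidable (u ≤ v ∧ ¬ v ≤ u))

/-- This is where the shape of `B5` enters: each edge has an end that can absorb a subdividing
element while the fibres over `zero` and `one` stay singletons. -/
theorem B5.cover_cases : ∀ p q : B5, p < q → (∀ r, p < r → ¬ r < q) →
    (p ≠ .zero ∧ p ≠ .one ∧ ∀ r, p < r → q ≤ r) ∨
      (q ≠ .zero ∧ q ≠ .one ∧ ∀ r, r < q → r ≤ p) := by
  decide

variable {P : Type*} [PartialOrder P]

-- Without `x`, the pair `y`, `z` is a covering pair, so its ends lie in one fibre or over a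
-- covering pair of `B5`.
theorem B5Fib.exists_of_slack {S : Set P} {π : P → B5} {x y z : P}
    (hs : Slack S x y z) (h : B5Fib (S \ {x}) π) : ∃ π' : P → B5, B5Fib S π' := by
  classical
  have hy : y ∈ S \ {x} := ⟨hs.mem_lower, hs.lower_lt.ne⟩
  have hz : z ∈ S \ {x} := ⟨hs.mem_upper, hs.lt_upper.ne'⟩
  have hyz : y < z := hs.lower_lt.trans hs.lt_upper
  have unique : ∀ q r : B5, q ≠ r → (∀ u ∈ S \ {x}, ∀ v ∈ S \ {x}, π u = r → π v = r → u = v) →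
      ∀ u ∈ S, ∀ v ∈ S, Function.update π x q u = r → Function.update π x q v = r → u = v := by
    intro q r hqr hr u hu v hv hur hvr
    have hux : u ≠ x := by
      rintro rfl
      exact hqr (by simpa using hur)
    have hvx : v ≠ x := by
      rintro rfl
      exact hqr (by simpa using hvr)
    rw [Function.update_of_ne hux] at hur
    rw [Function.update_of_ne hvx] at hvr
    exact hr u ⟨hu, hux⟩ v ⟨hv, hvx⟩ hur hvr
  have key : (π y ≠ .zero ∧ π y ≠ .one ∧ ∀ r, π y < r → π z ≤ r) ∨
      (π z ≠ .zero ∧ π z ≠ .one ∧ ∀ r, r < π z → r ≤ π y) := by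
    rcases (h.mono y hy z hz hyz.le).eq_or_lt with he | hl
    · left
      refine ⟨fun h0 => hyz.ne (h.zero_unique y hy z hz h0 (he ▸ h0)),
        fun h1 => hyz.ne (h.one_unique y hy z hz h1 (he ▸ h1)), fun r hr => he ▸ hr.le⟩
    · refine B5.cover_cases _ _ hl fun r hr hr' => ?_
      obtain ⟨u, hu, rfl⟩ := h.surj r
      exact hu.2 (hs.eq_of_between u hu.1 (h.lt y hy u hu hr) (h.lt u hu z hz hr'))
  rcases key with ⟨h0, h1, hup⟩ | ⟨h0, h1, hlow⟩
  · exact ⟨_, h.toChainFib.update_lower hs hup, unique _ _ h0 h.zero_unique,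
      unique _ _ h1 h.one_unique⟩
  · exact ⟨_, h.toChainFib.update_upper hs hlow, unique _ _ h0 h.zero_unique,
      unique _ _ h1 h.one_unique⟩

end B5Fibrations

end RCLattice
namespace RCLattice

/-! ### Contracting fibrations to `B5` -/

section Removal

variable {P Q : Type*} [PartialOrder P] [PartialOrder Q]

theorem exists_least_of_chain [Finite P] {F : Set P} (hne : F.Nonempty)
    (hF : ∀ u ∈ F, ∀ v ∈ F, u ≤ v ∨ v ≤ u) : ∃ m ∈ F, ∀ u ∈ F, m ≤ u := by
  obtain ⟨m, hm⟩ := F.toFinite.exists_minimal hne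
  refine ⟨m, hm.1, fun u hu => ?_⟩
  rcases hF m hm.1 u hu with h | h
  · exact h
  · exact hm.2 hu h

theorem ChainFib.exists_least [Finite P] {S : Set P} {π : P → Q} (h : ChainFib S π) (q : Q) :
    ∃ m ∈ S, π m = q ∧ ∀ u ∈ S, π u = q → m ≤ u := by
  obtain ⟨m, hm, hle⟩ := exists_least_of_chain (F := {u | u ∈ S ∧ π u = q}) (h.surj q)
    fun u hu v hv => h.chain u hu.1 v hv.1 (hu.2.trans hv.2.symm)
  exact ⟨m, hm.1, hm.2, fun u hu hq => hle u ⟨hu, hq⟩⟩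

theorem ChainFib.exists_greatest [Finite P] {S : Set P} {π : P → Q} (h : ChainFib S π) (q : Q) :
    ∃ m ∈ S, π m = q ∧ ∀ u ∈ S, π u = q → u ≤ m :=
  ChainFib.exists_least (P := Pᵒᵈ) h.dual q

theorem ChainFib.exists_next [Finite P] {S : Set P} {π : P → Q} (h : ChainFib S π) {u v : P}
    (hu : u ∈ S) (hv : v ∈ S) (huv : u < v) (hp : π u = π v) :
    ∃ z ∈ S, u < z ∧ π z = π u ∧ ∀ w ∈ S, u < w → z ≤ w := by
  obtain ⟨z, hz, hle⟩ := exists_least_of_chain (F := {w | w ∈ S ∧ π w = π u ∧ u < w})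
    ⟨v, hv, hp.symm, huv⟩ fun a ha b hb => h.chain a ha.1 b hb.1 (ha.2.1.trans hb.2.1.symm)
  refine ⟨z, hz.1, hz.2.2, hz.2.1, fun w hw huw => ?_⟩
  rcases (h.mono u hu w hw huw.le).eq_or_lt with he | hl
  · exact hle w ⟨hw, he.symm, huw⟩
  · exact (h.lt z hz.1 w hw (hz.2.1 ▸ hl)).le

/-- The bottom `x` of a chain with at least two elements is slack when its index has a greatest
element `q` below it: the lower neighbour is the top of the chain over `q`, the upper neighbour is
the next element of the same chain. That next element keeps the fibre nonempty after the removal. -/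
theorem ChainFib.exists_slack_lower [Finite P] {S : Set P} {π : P → Q} (h : ChainFib S π)
    {u v : P} (hu : u ∈ S) (hv : v ∈ S) (huv : u < v) (hp : π u = π v)
    (hq : ∃ q, q < π u ∧ ∀ r, r < π u → r ≤ q) :
    ∃ x y z, Slack S x y z ∧ ∃ w ∈ S, w ≠ x ∧ π w = π x := by
  obtain ⟨q, hqu, hq⟩ := hq
  obtain ⟨x, hx, hxu, hxle⟩ := h.exists_least (π u)
  obtain ⟨y, hy, rfl, hyge⟩ := h.exists_greatest q
  obtain ⟨z, hz, hxz, hzx, hzle⟩ := h.exists_next hx hv ((hxle u hu rfl).trans_lt huv)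
    (hxu.trans hp)
  have hyx : y < x := h.lt y hy x hx (hxu.symm ▸ hqu)
  refine ⟨x, y, z, ⟨hx, hy, hz, hyx, hxz, ?_, hzle, ?_⟩, z, hz, hxz.ne', hzx⟩
  · intro w hw hwx
    rcases (h.mono w hw x hx hwx.le).eq_or_lt with he | hl
    · exact absurd hwx (hxle w hw (he.trans hxu)).not_gt
    · rcases (hq _ (hxu ▸ hl)).eq_or_lt with he' | hl'
      · exact hyge w hw he'
      · exact (h.lt w hw y hy hl').le
  · intro w hw hyw hwz
    rcases (h.mono w hw z hz hwz.le).eq_or_lt with he | hl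
    · refine ((hxle w hw (he.trans (hzx.trans hxu))).eq_or_lt.resolve_right fun hxw => ?_).symm
      exact (hzle w hw hxw).not_gt hwz
    · rw [hzx, hxu] at hl
      have := le_antisymm (hq _ hl) (h.mono y hy w hw hyw.le)
      exact absurd hyw (hyge w hw this).not_gt

theorem ChainFib.exists_slack_upper [Finite P] {S : Set P} {π : P → Q} (h : ChainFib S π)
    {u v : P} (hu : u ∈ S) (hv : v ∈ S) (huv : u < v) (hp : π u = π v)
    (hq : ∃ q, π u < q ∧ ∀ r, π u < r → q ≤ r) :
    ∃ x y z, Slack S x y z ∧ ∃ w ∈ S, w ≠ x ∧ π w = π x := by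
  rw [hp] at hq
  obtain ⟨x, y, z, hs, hw⟩ := ChainFib.exists_slack_lower (P := Pᵒᵈ) h.dual (u := v) (v := u)
    hv hu huv hp.symm hq
  exact ⟨x, z, y, hs.dual, hw⟩

theorem B5.lower_or_upper : ∀ q : B5, q ≠ .zero → q ≠ .one →
    (∃ p, p < q ∧ ∀ r, r < q → r ≤ p) ∨ (∃ p, q < p ∧ ∀ r, q < r → p ≤ r) := by
  decide

theorem B5Fib.exists_slack [Finite P] {S : Set P} {π : P → B5} (h : B5Fib S π)
    (hinj : ¬ Set.InjOn π S) : ∃ x y z, Slack S x y z ∧ B5Fib (S \ {x}) π := by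
  have : ∃ u ∈ S, ∃ v ∈ S, u < v ∧ π u = π v := by
    rw [Set.InjOn] at hinj
    push Not at hinj
    obtain ⟨u, hu, v, hv, he, hne⟩ := hinj
    rcases h.chain u hu v hv he with hle | hle
    · exact ⟨u, hu, v, hv, lt_of_le_of_ne hle hne, he⟩
    · exact ⟨v, hv, u, hu, lt_of_le_of_ne hle hne.symm, he.symm⟩
  obtain ⟨u, hu, v, hv, huv, he⟩ := this
  have h0 : π u ≠ .zero := fun h0 => huv.ne (h.zero_unique u hu v hv h0 (he ▸ h0))
  have h1 : π u ≠ .one := fun h1 => huv.ne (h.one_unique u hu v hv h1 (he ▸ h1))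
  have : ∃ x y z, Slack S x y z ∧ ∃ w ∈ S, w ≠ x ∧ π w = π x := by
    rcases B5.lower_or_upper _ h0 h1 with hq | hq
    · exact h.exists_slack_lower hu hv huv he hq
    · exact h.exists_slack_upper hu hv huv he hq
  obtain ⟨x, y, z, hs, w, hw, hwx, hpw⟩ := this
  refine ⟨x, y, z, hs, ⟨⟨fun q => ?_, fun a ha b hb => h.lt a ha.1 b hb.1,
    fun a ha b hb => h.mono a ha.1 b hb.1, fun a ha b hb => h.chain a ha.1 b hb.1⟩,
    fun a ha b hb => h.zero_unique a ha.1 b hb.1, fun a ha b hb => h.one_unique a ha.1 b hb.1⟩⟩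
  obtain ⟨a, ha, rfl⟩ := h.surj q
  by_cases hax : a = x
  · exact ⟨w, ⟨hw, hwx⟩, hax ▸ hpw⟩
  · exact ⟨a, ⟨ha, hax⟩, rfl⟩

theorem B5Fib.le_iff_of_injOn {S : Set P} {π : P → B5} (h : B5Fib S π) (hinj : Set.InjOn π S)
    {u v : P} (hu : u ∈ S) (hv : v ∈ S) : π u ≤ π v ↔ u ≤ v := by
  refine ⟨fun hle => ?_, h.mono u hu v hv⟩
  rcases hle.eq_or_lt with he | hl
  · exact (hinj hu hv he).le
  · exact (h.lt u hu v hv hl).le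

theorem B5Fib.nonempty_orderIso {S : Set P} {π : P → B5} (h : B5Fib S π)
    (hinj : Set.InjOn π S) : Nonempty (S ≃o B5) := by
  let f : S → B5 := fun u => π u
  have hf : Function.Bijective f := by
    refine ⟨fun u v he => Subtype.ext (hinj u.2 v.2 he), fun q => ?_⟩
    obtain ⟨u, hu, rfl⟩ := h.surj q
    exact ⟨⟨u, hu⟩, rfl⟩
  exact ⟨⟨Equiv.ofBijective f hf, fun {u v} => h.le_iff_of_injOn hinj u.2 v.2⟩⟩

theorem B5Fib.of_orderIso {S : Set P} (e : S ≃o B5) : ∃ π : P → B5, B5Fib S π := by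
  classical
  let π : P → B5 := fun u => if hu : u ∈ S then e ⟨u, hu⟩ else .zero
  have hπ : ∀ u (hu : u ∈ S), π u = e ⟨u, hu⟩ := fun u hu => dif_pos hu
  have hinj : ∀ u ∈ S, ∀ v ∈ S, π u = π v → u = v := by
    intro u hu v hv he
    rw [hπ u hu, hπ v hv] at he
    exact congrArg Subtype.val (e.injective he)
  refine ⟨π, ⟨fun q => ⟨e.symm q, (e.symm q).2, ?_⟩, fun u hu v hv => ?_, fun u hu v hv => ?_,
    fun u hu v hv he => Or.inl (hinj u hu v hv he).le⟩,
    fun u hu v hv h1 h2 => hinj u hu v hv (h1.trans h2.symm),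
    fun u hu v hv h1 h2 => hinj u hu v hv (h1.trans h2.symm)⟩
  · rw [hπ _ (e.symm q).2]
    exact e.apply_symm_apply q
  · rw [hπ u hu, hπ v hv, e.lt_iff_lt]
    exact id
  · rw [hπ u hu, hπ v hv, e.le_iff_le]
    exact id

theorem B5Fib.induction [Finite P] {π : P → B5} {motive : Set P → Prop}
    (base : ∀ S, B5Fib S π → Set.InjOn π S → motive S)
    (step : ∀ S x y z, Slack S x y z → B5Fib (S \ {x}) π → motive (S \ {x}) → motive S)
    {S : Set P} (h : B5Fib S π) : motive S := by
  induction hn : S.ncard using Nat.strong_induction_on generalizing S with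
  | _ n ih =>
    by_cases hinj : Set.InjOn π S
    · exact base S h hinj
    · obtain ⟨x, y, z, hs, h'⟩ := h.exists_slack hinj
      refine step S x y z hs h' (ih _ ?_ h' rfl)
      rw [← hn]
      exact Set.ncard_sdiff_singleton_lt_of_mem hs.mem

/-- `B5` is itself a basic retract, so the contraction stops there. -/
theorem B5.not_slack : ∀ p q r : B5, ¬ (q < p ∧ p < r ∧ (∀ u, u < p → u ≤ q) ∧
    (∀ u, p < u → r ≤ u) ∧ ∀ u, q < u → u < r → u = p) := by
  decide

theorem B5Fib.isBasicRetract [Finite P] {S : Set P} {π : P → B5} (h : B5Fib S π)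
    (hinj : Set.InjOn π S) : IsBasicRetract S := by
  have hle {u v : P} (hu : u ∈ S) (hv : v ∈ S) := h.le_iff_of_injOn hinj hu hv
  have hlt {u v : P} (hu : u ∈ S) (hv : v ∈ S) : π u < π v ↔ u < v := by
    rw [lt_iff_le_not_ge, lt_iff_le_not_ge, hle hu hv, hle hv hu]
  rw [isBasicRetract_iff]
  intro x y z hs
  refine B5.not_slack (π x) (π y) (π z) ⟨(hlt hs.mem_lower hs.mem).2 hs.lower_lt,
    (hlt hs.mem hs.mem_upper).2 hs.lt_upper, ?_, ?_, ?_⟩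
  all_goals
    intro q
    obtain ⟨u, hu, rfl⟩ := h.surj q
  · rw [hlt hu hs.mem, hle hu hs.mem_lower]
    exact hs.le_lower u hu
  · rw [hlt hs.mem hu, hle hs.mem_upper hu]
    exact hs.upper_le u hu
  · rw [hlt hs.mem_lower hu, hlt hu hs.mem_upper]
    exact fun h1 h2 => congrArg π (hs.eq_of_between u hu h1 h2)

theorem B5.card_coverPairs :
    (Finset.univ.filter fun p : B5 × B5 => p.1 < p.2 ∧ ∀ r, p.1 < r → ¬ r < p.2).card = 10 := by
  decide

theorem B5Fib.ncard_of_injOn {S : Set P} {π : P → B5} (h : B5Fib S π)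
    (hinj : Set.InjOn π S) : S.ncard = 8 := by
  obtain ⟨e⟩ := h.nonempty_orderIso hinj
  rw [← Nat.card_coe_set_eq, Nat.card_congr e.toEquiv, Nat.card_eq_fintype_card]
  rfl

theorem B5Fib.ncard_coverPairs_of_injOn {S : Set P} {π : P → B5} (h : B5Fib S π)
    (hinj : Set.InjOn π S) : (coverPairs S).ncard = 10 := by
  have hle {u v : P} (hu : u ∈ S) (hv : v ∈ S) := h.le_iff_of_injOn hinj hu hv
  have hlt {u v : P} (hu : u ∈ S) (hv : v ∈ S) : π u < π v ↔ u < v := by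
    rw [lt_iff_le_not_ge, lt_iff_le_not_ge, hle hu hv, hle hv hu]
  rw [← B5.card_coverPairs, ← Set.ncard_coe_finset]
  refine Set.ncard_congr (fun p _ => (π p.1, π p.2)) ?_ ?_ ?_
  · rintro ⟨u, v⟩ ⟨hu, hv, huv, hb⟩
    simp only [Finset.coe_filter, Finset.mem_univ, true_and, Set.mem_ofPred_eq]
    refine ⟨(hlt hu hv).2 huv, fun r => ?_⟩
    obtain ⟨w, hw, rfl⟩ := h.surj r
    rw [hlt hu hw, hlt hw hv]
    exact hb w hw
  · rintro ⟨u, v⟩ ⟨u', v'⟩ huv huv' he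
    rw [Prod.mk.injEq] at he
    exact Prod.ext (hinj huv.1 huv'.1 he.1) (hinj huv.2.1 huv'.2.1 he.2)
  · rintro ⟨p, q⟩ hpq
    simp only [Finset.coe_filter, Finset.mem_univ, true_and, Set.mem_ofPred_eq] at hpq
    obtain ⟨u, hu, rfl⟩ := h.surj p
    obtain ⟨v, hv, rfl⟩ := h.surj q
    refine ⟨(u, v), ⟨hu, hv, (hlt hu hv).1 hpq.1, fun w hw h1 h2 => ?_⟩, rfl⟩
    exact hpq.2 (π w) ((hlt hu hw).2 h1) ((hlt hw hv).2 h2)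

/-- `B5` has ten edges on eight vertices, and each removal costs one edge and one vertex. This
yields nullity three. -/
theorem B5Fib.ncard_coverPairs [Finite P] {S : Set P} {π : P → B5} (h : B5Fib S π) :
    (coverPairs S).ncard = S.ncard + 2 := by
  refine h.induction (motive := fun S => (coverPairs S).ncard = S.ncard + 2) ?_ ?_
  · intro S h hinj
    rw [h.ncard_coverPairs_of_injOn hinj, h.ncard_of_injOn hinj]
  · intro S x y z hs _ ih
    rw [hs.ncard_coverPairs, ih]
    have := Set.ncard_sdiff_singleton_add_one hs.mem
    omega

theorem B5.two_neighbours : ∀ p : B5, ∃ q r, q ≠ r ∧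
    (((p < q ∧ ∀ s, p < s → ¬ s < q) ∨ (q < p ∧ ∀ s, q < s → ¬ s < p)) ∧
      ((p < r ∧ ∀ s, p < s → ¬ s < r) ∨ (r < p ∧ ∀ s, r < s → ¬ s < p))) := by
  decide

theorem B5Fib.minDegreeTwo_of_injOn {S : Set P} {π : P → B5} (h : B5Fib S π)
    (hinj : Set.InjOn π S) : MinDegreeTwo S := by
  have hle {u v : P} (hu : u ∈ S) (hv : v ∈ S) := h.le_iff_of_injOn hinj hu hv
  have hlt {u v : P} (hu : u ∈ S) (hv : v ∈ S) : π u < π v ↔ u < v := by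
    rw [lt_iff_le_not_ge, lt_iff_le_not_ge, hle hu hv, hle hv hu]
  have cov : ∀ u ∈ S, ∀ v ∈ S, (π u < π v ∧ ∀ s, π u < s → ¬ s < π v) → CovByIn S u v := by
    rintro u hu v hv ⟨huv, hb⟩
    exact ⟨hu, hv, (hlt hu hv).1 huv,
      fun w hw h1 h2 => hb (π w) ((hlt hu hw).2 h1) ((hlt hw hv).2 h2)⟩
  intro v hv
  obtain ⟨q, r, hqr, h1, h2⟩ := B5.two_neighbours (π v)
  obtain ⟨u, hu, rfl⟩ := h.surj q
  obtain ⟨w, hw, rfl⟩ := h.surj r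
  exact ⟨u, w, fun e => hqr (congrArg π e), h1.imp (cov v hv u hu) (cov u hu v hv),
    h2.imp (cov v hv w hw) (cov w hw v hv)⟩

theorem B5Fib.exists_retract [Finite P] {S : Set P} {π : P → B5} (h : B5Fib S π) :
    ∃ R, Relation.ReflTransGen RetractStep S R ∧ B5Fib R π ∧ Set.InjOn π R := by
  refine h.induction (motive := fun S => ∃ R, Relation.ReflTransGen RetractStep S R ∧
    B5Fib R π ∧ Set.InjOn π R) (fun S h hinj => ⟨S, .refl, h, hinj⟩) ?_
  rintro S x y z hs - ⟨R, hR, h⟩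
  exact ⟨R, hR.head (retractStep_iff.2 ⟨x, y, z, hs, rfl⟩), h⟩

theorem B5Fib.hasBasicBlock [Finite P] {π : P → B5} (h : B5Fib Set.univ π) :
    HasBasicBlock P B5 := by
  obtain ⟨R, hR, h, hinj⟩ := h.exists_retract
  exact ⟨R, ⟨R, ⟨hR, h.isBasicRetract hinj⟩, .refl,
    (h.minDegreeTwo_of_injOn hinj).not_isPendant⟩, h.nonempty_orderIso hinj⟩

theorem HasBasicBlock.exists_B5Fib [Finite P] (h : HasBasicBlock P B5)
    (hdeg : MinDegreeTwo (Set.univ : Set P)) : ∃ π : P → B5, B5Fib Set.univ π := by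
  obtain ⟨B, ⟨R, ⟨hR, -⟩, hB, -⟩, ⟨e⟩⟩ := h
  obtain rfl := reflTransGen_pendantStep_eq (minDegreeTwo_of_reflTransGen hdeg hR) hB
  have hfib := B5Fib.of_orderIso e
  clear e hB hdeg
  -- The induction runs backwards along the removals, so the ambient set has to vary while the final
  -- retract stays fixed.
  generalize (Set.univ : Set P) = S at hR ⊢
  induction hR using Relation.ReflTransGen.head_induction_on with
  | refl => exact hfib
  | head hstep _ ih =>
    obtain ⟨x, y, z, hs, rfl⟩ := retractStep_iff.1 hstep
    obtain ⟨π, hπ⟩ := ih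
    exact hπ.exists_of_slack hs

end Removal

end RCLattice
namespace RCLattice

/-! ### Unique successors and predecessors in a fibration -/

section Structure

variable {P : Type*} [PartialOrder P]

/-- There is a least element strictly above `w`. -/
def HasSucc (w : P) : Prop := ∃ z, w < z ∧ ∀ u, w < u → z ≤ u

/-- There is a greatest element strictly below `w`. -/
def HasPred (w : P) : Prop := ∃ z, z < w ∧ ∀ u, u < w → u ≤ z

/-- If a cover `z` of `w` is not below some `v > w`, then `z ⊓ v` must be `w`. The successor form
depends only on the order, so it transfers to fibrations. -/
theorem meetReducible_iff {α : Type*} [Lattice α] [Finite α] {w : α} :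
    MeetReducible w ↔ ¬ HasSucc w ∧ ∃ u, w < u := by
  constructor
  · rintro ⟨b, c, hb, hc, rfl⟩
    have hb' : b ⊓ c < b := lt_of_le_of_ne inf_le_left (Ne.symm hb)
    have hc' : b ⊓ c < c := lt_of_le_of_ne inf_le_right (Ne.symm hc)
    exact ⟨fun ⟨z, hz, hz'⟩ => hz.not_ge (le_inf (hz' b hb') (hz' c hc')), b, hb'⟩
  · rintro ⟨hs, u, hu⟩
    obtain ⟨z, hz, -⟩ := exists_covBy_le_of_lt hu
    have : ∃ v, w < v ∧ ¬ z ≤ v := by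
      by_contra! hcon
      exact hs ⟨z, hz.1, hcon⟩
    obtain ⟨v, hv, hzv⟩ := this
    refine ⟨z, v, hz.1.ne', hv.ne', ?_⟩
    rcases hz.eq_or_eq (le_inf hz.1.le hv.le) inf_le_left with h | h
    · exact h
    · exact absurd (inf_eq_left.1 h) hzv

theorem joinReducible_iff {α : Type*} [Lattice α] [Finite α] {w : α} :
    JoinReducible w ↔ ¬ HasPred w ∧ ∃ u, u < w :=
  meetReducible_iff (α := αᵒᵈ)

theorem ChainFib.hasSucc {Q : Type*} [PartialOrder Q] [Finite P] {π : P → Q}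
    (h : ChainFib Set.univ π) {w : P}
    (hw : (∃ v, w < v ∧ π w = π v) ∨ ∃ q, π w < q ∧ ∀ r, π w < r → q ≤ r) : HasSucc w := by
  by_cases hv : ∃ v, w < v ∧ π w = π v
  · obtain ⟨v, hv, he⟩ := hv
    obtain ⟨z, -, hz, -, hz'⟩ := h.exists_next trivial trivial hv he
    exact ⟨z, hz, fun u => hz' u trivial⟩
  · obtain ⟨q, hq, hq'⟩ := hw.resolve_left hv
    obtain ⟨z, -, rfl, hz⟩ := h.exists_least q
    refine ⟨z, h.lt w trivial z trivial hq, fun u hu => ?_⟩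
    rcases (h.mono w trivial u trivial hu.le).eq_or_lt with he | hl
    · exact absurd ⟨u, hu, he⟩ hv
    · rcases (hq' _ hl).eq_or_lt with he' | hl'
      · exact hz u trivial he'.symm
      · exact (h.lt z trivial u trivial hl').le

/-- The order-reversing involution of `B5`. -/
def B5.flip : B5 → B5
  | .zero => .one
  | .one => .zero
  | .a => .b
  | .b => .a
  | q => q

theorem B5.flip_lt_flip : ∀ p q : B5, p.flip < q.flip ↔ q < p := by decide

theorem B5.flip_le_flip : ∀ p q : B5, p.flip ≤ q.flip ↔ q ≤ p := by decide

theorem B5.flip_flip : ∀ p : B5, p.flip.flip = p := by decide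

theorem B5.flip_eq_iff {p q : B5} : p.flip = q ↔ p = q.flip :=
  ⟨fun h => by rw [← h, B5.flip_flip], fun h => by rw [h, B5.flip_flip]⟩

open OrderDual in
theorem B5Fib.dual {S : Set P} {π : P → B5} (h : B5Fib S π) :
    B5Fib (ofDual ⁻¹' S) (B5.flip ∘ π ∘ ofDual) where
  surj q := by
    obtain ⟨u, hu, he⟩ := h.surj q.flip
    exact ⟨toDual u, hu, B5.flip_eq_iff.2 he⟩
  lt u hu v hv huv := h.lt v hv u hu ((B5.flip_lt_flip _ _).1 huv)
  mono u hu v hv huv := (B5.flip_le_flip _ _).2 (h.mono v hv u hu huv)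
  chain u hu v hv huv := h.chain v hv u hu (by
    have := congrArg B5.flip huv
    simp only [Function.comp_apply, B5.flip_flip] at this
    exact this.symm)
  zero_unique u hu v hv h1 h2 :=
    h.one_unique u hu v hv (B5.flip_eq_iff.1 h1) (B5.flip_eq_iff.1 h2)
  one_unique u hu v hv h1 h2 :=
    h.zero_unique u hu v hv (B5.flip_eq_iff.1 h1) (B5.flip_eq_iff.1 h2)

theorem B5.exists_unique_upper : ∀ q : B5, q ≠ .zero → q ≠ .a → q ≠ .one →
    ∃ p, q < p ∧ ∀ r, q < r → p ≤ r := by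
  decide

theorem B5.le_zero : ∀ q : B5, q ≤ .c₂ → q ≤ .c₃ → q = .zero := by decide

theorem B5.le_a : ∀ q : B5, q ≤ .x → q ≤ .c₁ → q = .a ∨ q < .a := by decide

theorem B5.not_one_lt : ∀ q : B5, ¬ B5.one < q := by decide

theorem B5.eq_one_or_lt : ∀ q : B5, q = .one ∨ q < .one := by decide

theorem B5.lt_one : ∀ q : B5, q ≠ .one → q < .one := by decide

theorem B5.reducible_trichotomy : ∀ p q : B5,
    (p = .zero ∨ p = .a ∨ p = .b ∨ p = .one) → (q = .zero ∨ q = .a ∨ q = .b ∨ q = .one) →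
      p < q ∨ q < p ∨ p = q := by
  decide

variable {π : P → B5}

/-- A next element exists inside a chain, or at its top when the index has a least element above it.
Branching remains only at `zero` (towards `c₂`, `c₃`) and at the top of the chain over `a` (towards
`x`, `c₁`); over `one` nothing lies above. -/
theorem B5Fib.not_hasSucc_iff [Finite P] {w : P} (h : B5Fib Set.univ π) :
    ¬ HasSucc w ↔ π w = .zero ∨ (π w = .a ∧ ∀ u, π u = .a → u ≤ w) ∨ π w = .one := by
  constructor
  · intro hs
    by_contra! hcon
    obtain ⟨h0, ha, h1⟩ := hcon
    refine hs (h.hasSucc ?_)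
    by_cases hwa : π w = .a
    · left
      obtain ⟨u, hu, huw⟩ := ha hwa
      have := (h.chain u trivial w trivial (hu.trans hwa.symm)).resolve_left huw
      exact ⟨u, lt_of_le_of_ne this (fun e => huw e.ge), hwa.trans hu.symm⟩
    · exact Or.inr (B5.exists_unique_upper _ h0 hwa h1)
  · rintro (hw | ⟨hw, hmax⟩ | hw) ⟨z, hz, hz'⟩
    · obtain ⟨u, -, hu⟩ := h.surj .c₂
      obtain ⟨v, -, hv⟩ := h.surj .c₃
      have lt : ∀ q u, π u = q → B5.zero < q → w < u :=
        fun q u hu hq => h.lt w trivial u trivial (by rwa [hu, hw])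
      have h1 := h.mono z trivial u trivial (hz' u (lt _ u hu (by decide)))
      have h2 := h.mono z trivial v trivial (hz' v (lt _ v hv (by decide)))
      rw [hu] at h1
      rw [hv] at h2
      exact hz.ne (h.zero_unique w trivial z trivial hw (B5.le_zero _ h1 h2))
    · obtain ⟨u, -, hu⟩ := h.surj .x
      obtain ⟨v, -, hv⟩ := h.surj .c₁
      have lt : ∀ q u, π u = q → B5.a < q → w < u :=
        fun q u hu hq => h.lt w trivial u trivial (by rwa [hu, hw])
      have h1 := h.mono z trivial u trivial (hz' u (lt _ u hu (by decide)))
      have h2 := h.mono z trivial v trivial (hz' v (lt _ v hv (by decide)))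
      rw [hu] at h1
      rw [hv] at h2
      rcases B5.le_a _ h1 h2 with hza | hza
      · exact hz.not_ge (hmax z hza)
      · exact hz.not_gt (h.lt z trivial w trivial (hw ▸ hza))
    · rcases (h.mono w trivial z trivial hz.le).eq_or_lt with he | hl
      · exact hz.ne (h.one_unique w trivial z trivial hw (he ▸ hw))
      · exact B5.not_one_lt _ (hw ▸ hl)

theorem B5Fib.not_hasPred_iff [Finite P] {w : P} (h : B5Fib Set.univ π) :
    ¬ HasPred w ↔ π w = .one ∨ (π w = .b ∧ ∀ u, π u = .b → w ≤ u) ∨ π w = .zero := by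
  have := B5Fib.not_hasSucc_iff (P := Pᵒᵈ) h.dual (w := OrderDual.toDual w)
  simp only [Function.comp_apply, B5.flip_eq_iff, OrderDual.ofDual_toDual] at this
  exact this

theorem B5Fib.le_of_one (h : B5Fib Set.univ π) {w : P} (hw : π w = .one) : IsTop w := by
  intro u
  rcases B5.eq_one_or_lt (π u) with hu | hu
  · exact (h.one_unique u trivial w trivial hu hw).le
  · exact (h.lt u trivial w trivial (hw ▸ hu)).le

theorem B5Fib.ge_of_zero (h : B5Fib Set.univ π) {w : P} (hw : π w = .zero) : IsBot w :=
  B5Fib.le_of_one (P := Pᵒᵈ) h.dual (w := OrderDual.toDual w) (B5.flip_eq_iff.2 hw)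

theorem B5Fib.exists_gt_iff (h : B5Fib Set.univ π) {w : P} : (∃ u, w < u) ↔ π w ≠ .one := by
  constructor
  · rintro ⟨u, hu⟩ hw
    exact hu.not_ge (h.le_of_one hw u)
  · intro hw
    obtain ⟨u, -, hu⟩ := h.surj .one
    exact ⟨u, h.lt w trivial u trivial (hu ▸ B5.lt_one _ hw)⟩

theorem B5Fib.exists_lt_iff (h : B5Fib Set.univ π) {w : P} : (∃ u, u < w) ↔ π w ≠ .zero := by
  have := B5Fib.exists_gt_iff (P := Pᵒᵈ) h.dual (w := OrderDual.toDual w)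
  simp only [Function.comp_apply, B5.flip_eq_iff, OrderDual.ofDual_toDual, ne_eq] at this
  exact this

end Structure

/-! ### Fibred lattices belong to the class -/

section Blocks

variable {α : Type*} [Lattice α] [Finite α] {π : α → B5}

theorem B5Fib.meetReducible_iff (h : B5Fib Set.univ π) {w : α} :
    MeetReducible w ↔ π w = .zero ∨ (π w = .a ∧ ∀ u, π u = .a → u ≤ w) := by
  rw [RCLattice.meetReducible_iff, h.not_hasSucc_iff, h.exists_gt_iff]
  constructor
  · tauto
  · rintro (hw | hw)
    · simp [hw]
    · exact ⟨Or.inr (Or.inl hw), by simp [hw.1]⟩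

theorem B5Fib.joinReducible_iff (h : B5Fib Set.univ π) {w : α} :
    JoinReducible w ↔ π w = .one ∨ (π w = .b ∧ ∀ u, π u = .b → w ≤ u) := by
  rw [RCLattice.joinReducible_iff, h.not_hasPred_iff, h.exists_lt_iff]
  constructor
  · tauto
  · rintro (hw | hw)
    · simp [hw]
    · exact ⟨Or.inr (Or.inl hw), by simp [hw.1]⟩

theorem B5Fib.isBlock (h : B5Fib Set.univ π) : IsBlock α := by
  obtain ⟨t, -, ht⟩ := h.surj .one
  obtain ⟨b, -, hb⟩ := h.surj .zero
  exact ⟨inferInstance, ⟨t, h.le_of_one ht, h.joinReducible_iff.2 (Or.inl ht)⟩,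
    ⟨b, h.ge_of_zero hb, h.meetReducible_iff.2 (Or.inl hb)⟩⟩

theorem B5Fib.map_mem_of_mem_reducibles (h : B5Fib Set.univ π) {w : α} (hw : w ∈ reducibles α) :
    π w = .zero ∨ π w = .a ∨ π w = .b ∨ π w = .one := by
  rcases hw with hw | hw
  · rw [h.meetReducible_iff] at hw
    tauto
  · rw [h.joinReducible_iff] at hw
    tauto

/-- Each relevant fibre contributes one extremal element: the point over `zero` or `one`, the top
over `a`, the bottom over `b`. -/
theorem B5Fib.injOn_reducibles (h : B5Fib Set.univ π) : Set.InjOn π (reducibles α) := by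
  rintro u hu v hv he
  simp only [reducibles, Set.mem_ofPred_eq, h.meetReducible_iff, h.joinReducible_iff] at hu hv
  rw [← he] at hv
  have h0 := h.zero_unique u trivial v trivial
  have h1 := h.one_unique u trivial v trivial
  rcases hu with (hu | ⟨hu, hu'⟩) | (hu | ⟨hu, hu'⟩) <;>
    rcases hv with (hv | ⟨hv, hv'⟩) | (hv | ⟨hv, hv'⟩) <;>
      first
        | exact absurd (hu.symm.trans hv) (by decide)
        | exact h0 hu (he ▸ hu)
        | exact h1 hu (he ▸ hu)
        | exact le_antisymm (hv' u hu) (hu' v (he ▸ hu))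
        | exact le_antisymm (hu' v (he ▸ hu)) (hv' u hu)

theorem B5Fib.image_reducibles (h : B5Fib Set.univ π) :
    π '' reducibles α = ({.zero, .a, .b, .one} : Finset B5) := by
  ext q
  simp only [Finset.coe_insert, Finset.coe_singleton, Set.mem_insert_iff, Set.mem_singleton_iff]
  constructor
  · rintro ⟨w, hw, rfl⟩
    exact h.map_mem_of_mem_reducibles hw
  · rintro (rfl | rfl | rfl | rfl)
    · obtain ⟨w, -, hw⟩ := h.surj .zero
      exact ⟨w, Or.inl (h.meetReducible_iff.2 (Or.inl hw)), hw⟩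
    · obtain ⟨w, -, hw, hmax⟩ := h.exists_greatest .a
      exact ⟨w, Or.inl (h.meetReducible_iff.2 (Or.inr ⟨hw, fun u => hmax u trivial⟩)), hw⟩
    · obtain ⟨w, -, hw, hmin⟩ := h.exists_least .b
      exact ⟨w, Or.inr (h.joinReducible_iff.2 (Or.inr ⟨hw, fun u => hmin u trivial⟩)), hw⟩
    · obtain ⟨w, -, hw⟩ := h.surj .one
      exact ⟨w, Or.inr (h.joinReducible_iff.2 (Or.inl hw)), hw⟩

theorem B5Fib.isBlockB5 (h : B5Fib Set.univ π) : IsBlockB5 α := by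
  refine ⟨⟨h.isBlock, ?_, ?_, ?_⟩, h.hasBasicBlock⟩
  · rw [← h.injOn_reducibles.ncard_image, h.image_reducibles, Set.ncard_coe_finset]
    rfl
  · intro u hu v hv _
    rcases B5.reducible_trichotomy _ _ (h.map_mem_of_mem_reducibles hu)
      (h.map_mem_of_mem_reducibles hv) with hl | hl | he
    · exact Or.inl (h.lt u trivial v trivial hl).le
    · exact Or.inr (h.lt v trivial u trivial hl).le
    · exact h.chain u trivial v trivial he
  · obtain ⟨b, -, hb⟩ := h.surj .zero
    rw [nullity_eq (h.ge_of_zero hb), h.ncard_coverPairs, Set.ncard_univ]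
    push_cast
    ring

end Blocks

theorem isBlockB5_iff {α : Type*} [Lattice α] [Finite α] :
    IsBlockB5 α ↔ ∃ π : α → B5, B5Fib Set.univ π :=
  ⟨fun h => h.2.exists_B5Fib h.1.1.minDegreeTwo, fun ⟨_, h⟩ => h.isBlockB5⟩

end RCLattice
namespace RCLattice

/-! ### Lexicographic sums of chains are lattices -/

section Bounds

variable {P Q : Type*} [PartialOrder P] [PartialOrder Q]

/-- For incomparable elements the images are incomparable too, so their supremum `q` is strictly
above both, and the bottom of the chain over `q` is the supremum upstairs. -/
theorem ChainFib.exists_isLUB [Finite P] {π : P → Q} (h : ChainFib Set.univ π)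
    (hQ : ∀ p q : Q, ∃ s, IsLUB {p, q} s) (u v : P) : ∃ s, IsLUB {u, v} s := by
  by_cases huv : u ≤ v
  · exact ⟨v, by simp [huv], fun w hw => hw (by simp)⟩
  by_cases hvu : v ≤ u
  · exact ⟨u, by simp [hvu], fun w hw => hw (by simp)⟩
  have hp : π u ≠ π v := fun he => (h.chain u trivial v trivial he).elim huv hvu
  obtain ⟨q, hq, hq'⟩ := hQ (π u) (π v)
  have hu : π u < q := by
    refine lt_of_le_of_ne (hq (by simp)) fun he => ?_
    have : π v ≤ π u := he ▸ hq (by simp)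
    exact hvu (h.lt v trivial u trivial (lt_of_le_of_ne this hp.symm)).le
  have hv : π v < q := by
    refine lt_of_le_of_ne (hq (by simp)) fun he => ?_
    have : π u ≤ π v := he ▸ hq (by simp)
    exact huv (h.lt u trivial v trivial (lt_of_le_of_ne this hp)).le
  obtain ⟨s, -, rfl, hs⟩ := h.exists_least q
  refine ⟨s, ?_, fun w hw => ?_⟩
  · rintro w (rfl | rfl)
    · exact (h.lt w trivial s trivial hu).le
    · exact (h.lt w trivial s trivial hv).le
  · have : π s ≤ π w := by
      refine hq' ?_
      rintro r (rfl | rfl)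
      · exact h.mono u trivial w trivial (hw (by simp))
      · exact h.mono v trivial w trivial (hw (by simp))
    rcases this.eq_or_lt with he | hl
    · exact hs w trivial he.symm
    · exact (h.lt s trivial w trivial hl).le

theorem ChainFib.exists_isGLB [Finite P] {π : P → Q} (h : ChainFib Set.univ π)
    (hQ : ∀ p q : Q, ∃ s, IsGLB {p, q} s) (u v : P) : ∃ s, IsGLB {u, v} s :=
  ChainFib.exists_isLUB (P := Pᵒᵈ) h.dual hQ u v

theorem B5.exists_isLUB (p q : B5) : ∃ s, IsLUB {p, q} s := by
  have : ∀ p q : B5, ∃ s, p ≤ s ∧ q ≤ s ∧ ∀ t, p ≤ t → q ≤ t → s ≤ t := by decide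
  obtain ⟨s, h1, h2, h3⟩ := this p q
  exact ⟨s, by simp [h1, h2], fun t ht => h3 t (ht (by simp)) (ht (by simp))⟩

theorem B5.exists_isGLB (p q : B5) : ∃ s, IsGLB {p, q} s := by
  have : ∀ p q : B5, ∃ s, s ≤ p ∧ s ≤ q ∧ ∀ t, t ≤ p → t ≤ q → t ≤ s := by decide
  obtain ⟨s, h1, h2, h3⟩ := this p q
  exact ⟨s, by simp [h1, h2], fun t ht => h3 t (ht (by simp)) (ht (by simp))⟩

/-- The lattice structure of a partial order in which any two elements have a supremum and an
infimum. -/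
@[reducible]
noncomputable def latticeOfBounds (P : Type*) [inst : PartialOrder P]
    (hsup : ∀ u v : P, ∃ s, IsLUB {u, v} s) (hinf : ∀ u v : P, ∃ s, IsGLB {u, v} s) :
    Lattice P where
  toPartialOrder := inst
  sup u v := (hsup u v).choose
  inf u v := (hinf u v).choose
  le_sup_left u v := (hsup u v).choose_spec.1 (by simp)
  le_sup_right u v := (hsup u v).choose_spec.1 (by simp)
  sup_le u v w h1 h2 := (hsup u v).choose_spec.2 (by
    rintro x (rfl | rfl)
    exacts [h1, h2])
  inf_le_left u v := (hinf u v).choose_spec.1 (by simp)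
  inf_le_right u v := (hinf u v).choose_spec.1 (by simp)
  le_inf u v w h1 h2 := (hinf v w).choose_spec.2 (by
    rintro x (rfl | rfl)
    exacts [h1, h2])

end Bounds

/-! ### Fibre sizes determine the poset, and all sizes occur -/

section Sizes

/-- The number of elements of the fibre of `π` over `q`. -/
noncomputable def fibreSize {P Q : Type*} (π : P → Q) (q : Q) : ℕ := Nat.card {u // π u = q}

section

variable {P Q : Type*}

theorem sum_fibreSize [Finite P] [Fintype Q] (π : P → Q) : ∑ q, fibreSize π q = Nat.card P := by
  classical
  rw [← Nat.card_congr (Equiv.sigmaFiberEquiv π), Nat.card_sigma]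
  rfl

theorem fibreSize_comp_equiv {P' : Type*} (e : P' ≃ P) (π : P → Q) :
    fibreSize (π ∘ e) = fibreSize π := by
  funext q
  exact Nat.card_congr (e.subtypeEquiv fun u => Iff.rfl)

theorem fibreSize_equiv_comp (π : P → Q) (σ : Q ≃ Q) (q : Q) :
    fibreSize (σ ∘ π) q = fibreSize π (σ.symm q) :=
  Nat.card_congr ((Equiv.refl P).subtypeEquiv fun u => by simp [Equiv.eq_symm_apply])

theorem fibreSize_sigma_fst (k : Q → ℕ) :
    fibreSize (fun i : Σₗ q, Fin (k q) => i.1) = k := by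
  funext q
  have e : {i : Σₗ q, Fin (k q) // i.1 = q} ≃ Fin (k q) :=
    Equiv.sigmaSubtype (β := fun q => Fin (k q)) q
  rw [fibreSize, Nat.card_congr e, Nat.card_fin]

theorem fibreSize_eq_one_iff_unique {π : P → Q} {q : Q} (hq : ∃ u, π u = q) :
    fibreSize π q = 1 ↔ ∀ u v, π u = q → π v = q → u = v := by
  rw [fibreSize, Nat.card_eq_one_iff_unique]
  constructor
  · rintro ⟨h, -⟩ u v hu hv
    exact congrArg Subtype.val (h.elim ⟨u, hu⟩ ⟨v, hv⟩)
  · intro h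
    exact ⟨⟨fun u v => Subtype.ext (h u v u.2 v.2)⟩, hq.elim fun u hu => ⟨⟨u, hu⟩⟩⟩

end

variable {P Q : Type*} [PartialOrder P] [PartialOrder Q]

theorem ChainFib.nonempty_fibre_orderIso [Finite P] {π : P → Q} (h : ChainFib Set.univ π) (q : Q) :
    Nonempty (Fin (fibreSize π q) ≃o {u // π u = q}) := by
  classical
  let _ : LinearOrder {u // π u = q} :=
    { (inferInstance : PartialOrder {u // π u = q}) with
      le_total := fun u v => h.chain u trivial v trivial (u.2.trans v.2.symm)
      toDecidableLE := Classical.decRel _ }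
  have := Fintype.ofFinite {u // π u = q}
  exact ⟨Fintype.orderIsoFinOfCardEq _ Nat.card_eq_fintype_card.symm⟩

/-- A finite chain is determined by its length; identifying each fibre with its `Fin` gives the
standard model. -/
theorem ChainFib.nonempty_orderIso [Finite P] {π : P → Q} (h : ChainFib Set.univ π) :
    Nonempty ((Σₗ q, Fin (fibreSize π q)) ≃o P) := by
  have e : ∀ q, Fin (fibreSize π q) ≃o {u // π u = q} :=
    fun q => (h.nonempty_fibre_orderIso q).some
  let f : (Σₗ q, Fin (fibreSize π q)) → P := fun i => (e i.1 i.2).1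
  have hf : ∀ i, π (f i) = i.1 := fun i => (e i.1 i.2).2
  have hle : ∀ i j, f i ≤ f j ↔ i ≤ j := by
    intro i j
    rw [Sigma.Lex.le_def]
    constructor
    · intro hij
      have := h.mono _ trivial _ trivial hij
      rw [hf, hf] at this
      rcases this.eq_or_lt with he | hl
      · right
        obtain ⟨q, i⟩ := i
        obtain ⟨r, j⟩ := j
        obtain rfl : q = r := he
        exact ⟨rfl, (e q).le_iff_le.1 hij⟩
      · exact Or.inl hl
    · rintro (hl | ⟨he, hij⟩)
      · exact (h.lt _ trivial _ trivial (by rwa [hf, hf])).le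
      · obtain ⟨q, i⟩ := i
        obtain ⟨r, j⟩ := j
        obtain rfl : q = r := he
        exact (e q).le_iff_le.2 hij
  refine ⟨RelIso.ofSurjective (OrderEmbedding.ofMapLEIff f hle) fun u => ?_⟩
  refine ⟨⟨π u, (e (π u)).symm ⟨u, rfl⟩⟩, ?_⟩
  exact congrArg Subtype.val ((e (π u)).apply_symm_apply ⟨u, rfl⟩)

theorem ChainFib.nonempty_orderIso_of_fibreSize_eq {P' : Type*} [PartialOrder P'] [Finite P]
    [Finite P'] {π : P → Q} {π' : P' → Q} (h : ChainFib Set.univ π) (h' : ChainFib Set.univ π')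
    (he : fibreSize π = fibreSize π') : Nonempty (P ≃o P') := by
  obtain ⟨e⟩ := h.nonempty_orderIso
  obtain ⟨e'⟩ := h'.nonempty_orderIso
  rw [← he] at e'
  exact ⟨e.symm.trans e'⟩

theorem chainFib_sigma_fst {k : Q → ℕ} (hk : ∀ q, 0 < k q) :
    ChainFib (Set.univ : Set (Σₗ q, Fin (k q))) (fun i => i.1) where
  surj q := ⟨⟨q, 0, hk q⟩, trivial, rfl⟩
  lt i _ j _ hij := Sigma.Lex.lt_def.2 (Or.inl hij)
  mono i _ j _ hij := by
    rcases Sigma.Lex.le_def.1 hij with hl | ⟨he, -⟩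
    exacts [hl.le, he.le]
  chain i _ j _ hij := by
    obtain ⟨q, i⟩ := i
    obtain ⟨r, j⟩ := j
    obtain rfl : q = r := hij
    exact (le_total i j).imp (fun h => Sigma.Lex.le_def.2 (Or.inr ⟨rfl, h⟩))
      (fun h => Sigma.Lex.le_def.2 (Or.inr ⟨rfl, h⟩))

theorem ChainFib.comp_orderIso {P' : Type*} [PartialOrder P'] {π : P → Q}
    (h : ChainFib Set.univ π) (e : P' ≃o P) : ChainFib Set.univ (π ∘ e) where
  surj q := by
    obtain ⟨u, -, hu⟩ := h.surj q
    exact ⟨e.symm u, trivial, by simpa using hu⟩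
  lt u _ v _ huv := e.lt_iff_lt.1 (h.lt _ trivial _ trivial huv)
  mono u _ v _ huv := h.mono _ trivial _ trivial (e.le_iff_le.2 huv)
  chain u _ v _ huv := by
    simpa using h.chain (e u) trivial (e v) trivial huv

theorem ChainFib.orderIso_comp {π : P → Q} (h : ChainFib Set.univ π) (σ : Q ≃o Q) :
    ChainFib Set.univ (σ ∘ π) where
  surj q := by
    obtain ⟨u, -, hu⟩ := h.surj (σ.symm q)
    exact ⟨u, trivial, by simp [hu]⟩
  lt u _ v _ huv := h.lt _ trivial _ trivial (σ.lt_iff_lt.1 huv)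
  mono u _ v _ huv := σ.le_iff_le.2 (h.mono _ trivial _ trivial huv)
  chain u _ v _ huv := h.chain _ trivial _ trivial (σ.injective huv)

theorem ChainFib.fibreSize_pos [Finite P] {S : Set P} {π : P → Q} (h : ChainFib S π) (q : Q) :
    0 < fibreSize π q := by
  obtain ⟨u, -, hu⟩ := h.surj q
  have : Nonempty {u // π u = q} := ⟨⟨u, hu⟩⟩
  exact Nat.card_pos

theorem b5Fib_iff {π : P → B5} : B5Fib Set.univ π ↔
    ChainFib Set.univ π ∧ fibreSize π .zero = 1 ∧ fibreSize π .one = 1 := by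
  constructor
  · intro h
    have hne : ∀ q, ∃ u, π u = q := fun q => by
      obtain ⟨u, -, hu⟩ := h.surj q
      exact ⟨u, hu⟩
    exact ⟨h.toChainFib,
      (fibreSize_eq_one_iff_unique (hne _)).2 fun u v => h.zero_unique u trivial v trivial,
      (fibreSize_eq_one_iff_unique (hne _)).2 fun u v => h.one_unique u trivial v trivial⟩
  · rintro ⟨h, h0, h1⟩
    have hne : ∀ q, ∃ u, π u = q := fun q => by
      obtain ⟨u, -, hu⟩ := h.surj q
      exact ⟨u, hu⟩
    exact ⟨h, fun u _ v _ => (fibreSize_eq_one_iff_unique (hne _)).1 h0 u v,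
      fun u _ v _ => (fibreSize_eq_one_iff_unique (hne _)).1 h1 u v⟩

/-- The poset `P` is fibred over `B5`, with fibres of the sizes prescribed by `k`. -/
def HasFibreSizes (P : Type*) [PartialOrder P] (k : B5 → ℕ) : Prop :=
  ∃ π : P → B5, B5Fib Set.univ π ∧ fibreSize π = k

theorem exists_lattice_of_equiv {X : Type*} {π : P → B5} [Finite P] (h : B5Fib Set.univ π)
    (e : X ≃ P) : ∃ L : Lattice X, @HasFibreSizes X L.toPartialOrder (fibreSize π) := by
  let _ : PartialOrder X := PartialOrder.lift e e.injective
  have : Finite X := .of_equiv P e.symm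
  let e' : X ≃o P := ⟨e, Iff.rfl⟩
  have hfib := h.toChainFib.comp_orderIso e'
  have hsize : fibreSize (π ∘ e') = fibreSize π := fibreSize_comp_equiv e π
  have h01 := (b5Fib_iff.1 h).2
  rw [← hsize] at h01
  exact ⟨latticeOfBounds X (hfib.exists_isLUB B5.exists_isLUB)
    (hfib.exists_isGLB B5.exists_isGLB), _, b5Fib_iff.2 ⟨hfib, h01⟩, hsize⟩

theorem exists_lattice_hasFibreSizes {X : Type*} [Finite X] {k : B5 → ℕ} (hk : ∀ q, 0 < k q)
    (hsum : ∑ q, k q = Nat.card X) (h0 : k .zero = 1) (h1 : k .one = 1) :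
    ∃ L : Lattice X, @HasFibreSizes X L.toPartialOrder k := by
  have hcard : Nat.card X = Nat.card (Σₗ q, Fin (k q)) := by
    rw [← sum_fibreSize (fun i : Σₗ q, Fin (k q) => i.1), fibreSize_sigma_fst, hsum]
  have : Finite (Σₗ q, Fin (k q)) := inferInstanceAs (Finite (Σ q, Fin (k q)))
  have hfib : B5Fib (Set.univ : Set (Σₗ q, Fin (k q))) (fun i => i.1) :=
    b5Fib_iff.2 ⟨chainFib_sigma_fst hk, by rw [fibreSize_sigma_fst, h0],
      by rw [fibreSize_sigma_fst, h1]⟩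
  have := exists_lattice_of_equiv hfib
    (((Finite.equivFin X).trans (finCongr hcard)).trans (Finite.equivFin _).symm)
  rwa [fibreSize_sigma_fst] at this

end Sizes

end RCLattice
namespace RCLattice

/-! ### Recovering the fibre sizes from the order -/

section Uniqueness

theorem card_subtype_pair {P : Type*} [Finite P] {Q : Type*} (π : P → Q) {q r : Q} (hqr : q ≠ r) :
    Nat.card {u // π u = q ∨ π u = r} = fibreSize π q + fibreSize π r := by
  classical
  have := Fintype.ofFinite P
  rw [fibreSize, fibreSize, Nat.card_eq_fintype_card, Nat.card_eq_fintype_card,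
    Nat.card_eq_fintype_card]
  refine Fintype.card_subtype_or_disjoint _ _ ?_
  rw [Pi.disjoint_iff]
  intro u
  rw [Prop.disjoint_iff]
  by_contra! hcon
  exact hqr (hcon.1.symm.trans hcon.2)

theorem fibreSize_add_eq {P : Type*} [Finite P] {Q : Type*} {π π' : P → Q} {q r : Q} (hqr : q ≠ r)
    (h : ∀ u, π u = q ∨ π u = r ↔ π' u = q ∨ π' u = r) :
    fibreSize π q + fibreSize π r = fibreSize π' q + fibreSize π' r := by
  rw [← card_subtype_pair π hqr, ← card_subtype_pair π' hqr]
  exact Nat.card_congr (Equiv.subtypeEquivRight h)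

variable {P : Type*} [PartialOrder P]

theorem ChainFib.map_eq_iff {Q : Type*} [PartialOrder Q] {π : P → Q} (h : ChainFib Set.univ π)
    {u v : P} (huv : π u ≤ π v → π u = π v) (hvu : π v ≤ π u → π v = π u) :
    π u = π v ↔ u ≤ v ∨ v ≤ u := by
  refine ⟨h.chain u trivial v trivial, ?_⟩
  rintro (hle | hle)
  · exact huv (h.mono u trivial v trivial hle)
  · exact (hvu (h.mono v trivial u trivial hle)).symm

/-- Over two incomparable indices, the fibres are the comparability classes of their union. Both
fibrations therefore split the same set in the same way, up to the names of the two parts. -/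
theorem fibreSize_eq_or {Q : Type*} [PartialOrder Q] {π π' : P → Q}
    (hπ : ChainFib Set.univ π) (hπ' : ChainFib Set.univ π') {q r : Q} (hqr : ¬ q ≤ r)
    (hrq : ¬ r ≤ q) (h : ∀ u, π u = q ∨ π u = r ↔ π' u = q ∨ π' u = r) :
    fibreSize π q = fibreSize π' q ∨ fibreSize π q = fibreSize π' r := by
  obtain ⟨u, -, hu⟩ := hπ.surj q
  have anti : ∀ s t, (s = q ∨ s = r) → (t = q ∨ t = r) → s ≤ t → s = t := by
    rintro s t (rfl | rfl) (rfl | rfl) hst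
    exacts [rfl, absurd hst hqr, absurd hst hrq, rfl]
  have hu' := (h u).1 (Or.inl hu)
  have key : ∀ v, π v = q ↔ π' v = π' u := by
    intro v
    by_cases hv : π v = q ∨ π v = r
    · have hv' := (h v).1 hv
      rw [← hu, hπ.map_eq_iff (anti _ _ hv (Or.inl hu)) (anti _ _ (Or.inl hu) hv),
        hπ'.map_eq_iff (anti _ _ hv' hu') (anti _ _ hu' hv')]
    · refine ⟨fun e => absurd (Or.inl e) hv, fun e => absurd ((h v).2 ?_) hv⟩
      rwa [e]
  have : fibreSize π q = fibreSize π' (π' u) := Nat.card_congr (Equiv.subtypeEquivRight key)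
  rcases hu' with e | e
  · exact Or.inl (e ▸ this)
  · exact Or.inr (e ▸ this)

theorem B5.eq_zero_or_a_iff : ∀ q : B5, q ≤ .a ↔ q = .zero ∨ q = .a := by decide

theorem B5.eq_x_or_c₁_iff : ∀ q : B5, q = .x ∨ q = .c₁ ↔ .a < q ∧ q < .b := by decide

theorem B5.eq_c₂_or_c₃_iff : ∀ q : B5, q = .c₂ ∨ q = .c₃ ↔ ¬ (q = .zero ∨ q = .a) ∧ ¬ .a < q := by
  decide

variable {π π' : P → B5}

/-- The right-hand side does not mention `π`, so all fibrations of `P` share the top of the chain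
over `a`. -/
theorem B5Fib.map_eq_a_iff [Finite P] (h : B5Fib Set.univ π) {w : P} :
    (π w = .a ∧ ∀ u, π u = .a → u ≤ w) ↔ ¬ HasSucc w ∧ (∃ u, w < u) ∧ ∃ u, u < w := by
  rw [h.not_hasSucc_iff, h.exists_gt_iff, h.exists_lt_iff]
  constructor
  · rintro ⟨hw, hmax⟩
    exact ⟨Or.inr (Or.inl ⟨hw, hmax⟩), by simp [hw]⟩
  · tauto

theorem B5Fib.le_iff_of_greatest (h : B5Fib Set.univ π) {w : P}
    (hw : π w = .a ∧ ∀ u, π u = .a → u ≤ w) (u : P) :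
    u ≤ w ↔ π u = .zero ∨ π u = .a := by
  rw [← B5.eq_zero_or_a_iff]
  constructor
  · intro hu
    exact hw.1 ▸ h.mono u trivial w trivial hu
  · intro hu
    rcases hu.eq_or_lt with he | hl
    · exact hw.2 u he
    · exact (h.lt u trivial w trivial (hw.1 ▸ hl)).le

theorem B5Fib.lt_iff_of_greatest (h : B5Fib Set.univ π) {w : P}
    (hw : π w = .a ∧ ∀ u, π u = .a → u ≤ w) (u : P) : w < u ↔ .a < π u := by
  constructor
  · intro hu
    refine lt_of_le_of_ne (hw.1 ▸ h.mono w trivial u trivial hu.le) fun he => ?_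
    exact hu.not_ge (hw.2 u he.symm)
  · intro hu
    exact h.lt w trivial u trivial (hw.1 ▸ hu)

theorem B5Fib.same_lower [Finite P] (h : B5Fib Set.univ π) (h' : B5Fib Set.univ π') (u : P) :
    (π u = .zero ∨ π u = .a ↔ π' u = .zero ∨ π' u = .a) ∧ (.a < π u ↔ .a < π' u) := by
  obtain ⟨w, -, hw, hmax⟩ := h.exists_greatest .a
  have hA : π w = .a ∧ ∀ u, π u = .a → u ≤ w := ⟨hw, fun u => hmax u trivial⟩
  have hA' := h'.map_eq_a_iff.2 (h.map_eq_a_iff.1 hA)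
  rw [← h.le_iff_of_greatest hA, ← h'.le_iff_of_greatest hA', ← h.lt_iff_of_greatest hA,
    ← h'.lt_iff_of_greatest hA']
  exact ⟨Iff.rfl, Iff.rfl⟩

theorem B5Fib.same_upper [Finite P] (h : B5Fib Set.univ π) (h' : B5Fib Set.univ π') (u : P) :
    (π u = .one ∨ π u = .b ↔ π' u = .one ∨ π' u = .b) ∧ (π u < .b ↔ π' u < .b) := by
  have := B5Fib.same_lower (P := Pᵒᵈ) h.dual h'.dual (OrderDual.toDual u)
  simp only [Function.comp_apply, B5.flip_eq_iff, OrderDual.ofDual_toDual] at this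
  exact ⟨this.1, ((B5.flip_lt_flip .b _).symm.trans this.2).trans (B5.flip_lt_flip .b _)⟩

theorem HasFibreSizes.compare [Finite P] {k k' : B5 → ℕ} (h : HasFibreSizes P k) (h' : HasFibreSizes P k') :
    k .a = k' .a ∧ k .b = k' .b ∧ k .x + k .c₁ = k' .x + k' .c₁ ∧ k .c₂ + k .c₃ = k' .c₂ + k' .c₃ ∧
      (k .x = k' .x ∨ k .x = k' .c₁) ∧ (k .c₂ = k' .c₂ ∨ k .c₂ = k' .c₃) := by
  obtain ⟨π, h, rfl⟩ := h
  obtain ⟨π', h', rfl⟩ := h'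
  have hx : ∀ u, π u = .x ∨ π u = .c₁ ↔ π' u = .x ∨ π' u = .c₁ := fun u => by
    rw [B5.eq_x_or_c₁_iff, B5.eq_x_or_c₁_iff, (h.same_lower h' u).2, (h.same_upper h' u).2]
  have hc : ∀ u, π u = .c₂ ∨ π u = .c₃ ↔ π' u = .c₂ ∨ π' u = .c₃ := fun u => by
    rw [B5.eq_c₂_or_c₃_iff, B5.eq_c₂_or_c₃_iff, (h.same_lower h' u).1, (h.same_lower h' u).2]
  -- These compare the sizes over `{zero, a}` and `{one, b}`; the singleton fibres over `zero` and
  -- `one` are subtracted at the end.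
  have ha := fibreSize_add_eq (by decide) fun u => (h.same_lower h' u).1
  have hb := fibreSize_add_eq (by decide) fun u => (h.same_upper h' u).1
  obtain ⟨-, h0, h1⟩ := b5Fib_iff.1 h
  obtain ⟨-, h0', h1'⟩ := b5Fib_iff.1 h'
  exact ⟨by omega, by omega, fibreSize_add_eq (by decide) hx, fibreSize_add_eq (by decide) hc,
    fibreSize_eq_or h.toChainFib h'.toChainFib (by decide) (by decide) hx,
    fibreSize_eq_or h.toChainFib h'.toChainFib (by decide) (by decide) hc⟩

theorem HasFibreSizes.eq_of_le [Finite P] {k k' : B5 → ℕ} (h : HasFibreSizes P k) (h' : HasFibreSizes P k')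
    (hk : k .x ≤ k .c₁ ∧ k .c₂ ≤ k .c₃) (hk' : k' .x ≤ k' .c₁ ∧ k' .c₂ ≤ k' .c₃) : k = k' := by
  have := h.compare h'
  obtain ⟨π, h, rfl⟩ := h
  obtain ⟨π', h', rfl⟩ := h'
  obtain ⟨-, h0, h1⟩ := b5Fib_iff.1 h
  obtain ⟨-, h0', h1'⟩ := b5Fib_iff.1 h'
  funext q
  cases q <;> omega

theorem HasFibreSizes.comp_orderIso {P' : Type*} [PartialOrder P'] {k : B5 → ℕ}
    (h : HasFibreSizes P k) (e : P' ≃o P) : HasFibreSizes P' k := by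
  obtain ⟨π, h, rfl⟩ := h
  have hsize : fibreSize (π ∘ e) = fibreSize π := fibreSize_comp_equiv e.toEquiv π
  have := b5Fib_iff.1 h
  rw [← hsize] at this
  exact ⟨π ∘ e, b5Fib_iff.2 ⟨h.toChainFib.comp_orderIso e, this.2⟩, hsize⟩

theorem HasFibreSizes.nonempty_orderIso [Finite P] {P' : Type*} [PartialOrder P'] [Finite P'] {k : B5 → ℕ}
    (h : HasFibreSizes P k) (h' : HasFibreSizes P' k) : Nonempty (P ≃o P') := by
  obtain ⟨π, h, rfl⟩ := h
  obtain ⟨π', h', he⟩ := h'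
  exact h.toChainFib.nonempty_orderIso_of_fibreSize_eq h'.toChainFib he.symm

/-- The automorphism of `B5` exchanging `x` and `c₁`. -/
def B5.swapInner : B5 → B5
  | .x => .c₁
  | .c₁ => .x
  | q => q

/-- The automorphism of `B5` exchanging `c₂` and `c₃`. -/
def B5.swapOuter : B5 → B5
  | .c₂ => .c₃
  | .c₃ => .c₂
  | q => q

theorem HasFibreSizes.comp_involutive {k : B5 → ℕ} (h : HasFibreSizes P k) {σ : B5 → B5}
    (hσ : Function.Involutive σ) (hle : ∀ p q, σ p ≤ σ q ↔ p ≤ q) (h0 : σ .zero = .zero)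
    (h1 : σ .one = .one) : HasFibreSizes P (k ∘ σ) := by
  obtain ⟨π, h, rfl⟩ := h
  let e : B5 ≃o B5 := ⟨hσ.toPerm, fun {p q} => hle p q⟩
  have hsize : fibreSize (e ∘ π) = fibreSize π ∘ σ := funext (fibreSize_equiv_comp π hσ.toPerm)
  obtain ⟨-, h2, h3⟩ := b5Fib_iff.1 h
  refine ⟨e ∘ π, b5Fib_iff.2 ⟨h.toChainFib.orderIso_comp e, ?_, ?_⟩, hsize⟩
  · rw [hsize, Function.comp_apply, h0, h2]
  · rw [hsize, Function.comp_apply, h1, h3]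

/-- The two commuting automorphisms of `B5` sort each pair separately; the outer swap does not
disturb `x` and `c₁`. -/
theorem HasFibreSizes.exists_normal {k : B5 → ℕ} (h : HasFibreSizes P k) :
    ∃ k', HasFibreSizes P k' ∧ k' .x ≤ k' .c₁ ∧ k' .c₂ ≤ k' .c₃ := by
  have : ∃ k', HasFibreSizes P k' ∧ k' .x ≤ k' .c₁ := by
    rcases le_total (k .x) (k .c₁) with hk | hk
    · exact ⟨k, h, hk⟩
    · exact ⟨_, h.comp_involutive (σ := B5.swapInner) (by unfold Function.Involutive; decide)
        (by decide) rfl rfl, hk⟩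
  obtain ⟨k', h', hx⟩ := this
  rcases le_total (k' .c₂) (k' .c₃) with hk | hk
  · exact ⟨k', h', hx, hk⟩
  · exact ⟨_, h'.comp_involutive (σ := B5.swapOuter) (by unfold Function.Involutive; decide)
      (by decide) rfl rfl, hx, hk⟩

theorem HasFibreSizes.pos [Finite P] {k : B5 → ℕ} (h : HasFibreSizes P k) (q : B5) : 0 < k q := by
  obtain ⟨π, h, rfl⟩ := h
  exact h.toChainFib.fibreSize_pos q

theorem HasFibreSizes.sum_eq [Finite P] {k : B5 → ℕ} (h : HasFibreSizes P k) : ∑ q, k q = Nat.card P := by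
  obtain ⟨π, h, rfl⟩ := h
  exact sum_fibreSize π

theorem HasFibreSizes.zero_one {k : B5 → ℕ} (h : HasFibreSizes P k) : k .zero = 1 ∧ k .one = 1 := by
  obtain ⟨π, h, rfl⟩ := h
  exact (b5Fib_iff.1 h).2

end Uniqueness

/-! ### Counting normalised fibre sizes -/

section Counting

/-- A partition into two parts is determined by its smaller part, which runs from `1` to `n / 2`. -/
theorem numPartitions_two (n : ℕ) : numPartitions n 2 = n / 2 := by
  have hmem : ∀ i : Finset.Icc 1 (n / 2), 1 ≤ i.1 ∧ 2 * i.1 ≤ n := fun i => by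
    have := Finset.mem_Icc.1 i.2
    omega
  let f : Finset.Icc 1 (n / 2) → {p : n.Partition // p.parts.card = 2} := fun i =>
    ⟨⟨{i.1, n - i.1}, by
      have := hmem i
      intro m hm
      simp only [Multiset.insert_eq_cons, Multiset.mem_cons, Multiset.mem_singleton] at hm
      omega, by
      have := hmem i
      simp only [Multiset.insert_eq_cons, Multiset.sum_cons, Multiset.sum_singleton]
      omega⟩, rfl⟩
  have hf : Function.Bijective f := by
    constructor
    · intro i i' he
      have := hmem i
      have := hmem i'
      have he' : ({i.1, n - i.1} : Multiset ℕ) = {i'.1, n - i'.1} :=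
        congrArg (fun p : {p : n.Partition // p.parts.card = 2} => p.1.parts) he
      have hi : i.1 ∈ ({i'.1, n - i'.1} : Multiset ℕ) := he' ▸ by simp
      simp only [Multiset.insert_eq_cons, Multiset.mem_cons, Multiset.mem_singleton] at hi
      exact Subtype.ext (by omega)
    · rintro ⟨⟨parts, hpos, hsum⟩, hcard⟩
      obtain ⟨r, s, rfl⟩ := Multiset.card_eq_two.1 hcard
      have hr : 0 < r := hpos (by simp)
      have hs : 0 < s := hpos (by simp)
      simp only [Multiset.insert_eq_cons, Multiset.sum_cons, Multiset.sum_singleton] at hsum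
      rcases le_total r s with hrs | hrs
      · refine ⟨⟨r, Finset.mem_Icc.2 (by omega)⟩, Subtype.ext (Nat.Partition.ext ?_)⟩
        change ({r, n - r} : Multiset ℕ) = {r, s}
        rw [show n - r = s by omega]
      · refine ⟨⟨s, Finset.mem_Icc.2 (by omega)⟩, Subtype.ext (Nat.Partition.ext ?_)⟩
        change ({s, n - s} : Multiset ℕ) = {r, s}
        rw [show n - s = r by omega, Multiset.pair_comm]
  rw [numPartitions, ← Fintype.card_congr (Equiv.ofBijective f hf), Fintype.card_coe,
    Nat.card_Icc, Nat.add_sub_cancel]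

/-- Indices `(p, t, i, r, s)` of the normalised fibre sizes of total `j`: the chains over `c₂` and
`c₃` have `s` and `p - 2 - s` elements, those over `a` and `b` have `i` and `t + 1 - i`, and those
over `x` and `c₁` have `r` and `j - p - t - 1 - r`. -/
def sizeIndices (j : ℕ) : Finset (Σ _ : ℕ, Σ _ : ℕ, ℕ × ℕ × ℕ) :=
  (Finset.Icc 4 (j - 4)).sigma fun p => (Finset.Icc 1 (j - p - 3)).sigma fun t =>
    Finset.Icc 1 t ×ˢ Finset.Icc 1 ((j - p - t - 1) / 2) ×ˢ Finset.Icc 1 ((p - 2) / 2)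

theorem card_sizeIndices (j : ℕ) : (sizeIndices j).card =
    ∑ p ∈ Finset.Icc 4 (j - 4), ∑ t ∈ Finset.Icc 1 (j - p - 3),
      t * numPartitions (j - p - t - 1) 2 * numPartitions (p - 2) 2 := by
  simp only [sizeIndices, Finset.card_sigma, Finset.card_product, Nat.card_Icc,
    Nat.add_sub_cancel, numPartitions_two, mul_assoc]

/-- The fibre sizes belonging to an index. -/
def sizesOfIndex (j : ℕ) : (Σ _ : ℕ, Σ _ : ℕ, ℕ × ℕ × ℕ) → B5 → ℕ
  | ⟨_, _, _, _, _⟩, .zero => 1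
  | ⟨_, _, _, _, _⟩, .one => 1
  | ⟨_, _, i, _, _⟩, .a => i
  | ⟨_, t, i, _, _⟩, .b => t + 1 - i
  | ⟨_, _, _, r, _⟩, .x => r
  | ⟨p, t, _, r, _⟩, .c₁ => j - p - t - 1 - r
  | ⟨_, _, _, _, s⟩, .c₂ => s
  | ⟨p, _, _, _, s⟩, .c₃ => p - 2 - s

theorem mem_sizeIndices {j p t i r s : ℕ} : (⟨p, t, i, r, s⟩ : Σ _ : ℕ, Σ _ : ℕ, ℕ × ℕ × ℕ) ∈
    sizeIndices j ↔ (4 ≤ p ∧ p ≤ j - 4) ∧ (1 ≤ t ∧ t ≤ j - p - 3) ∧ (1 ≤ i ∧ i ≤ t) ∧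
      (1 ≤ r ∧ r ≤ (j - p - t - 1) / 2) ∧ 1 ≤ s ∧ s ≤ (p - 2) / 2 := by
  simp only [sizeIndices, Finset.mem_sigma, Finset.mem_product, Finset.mem_Icc]

theorem B5.sum_eq (k : B5 → ℕ) : ∑ q, k q =
    k .zero + k .a + k .x + k .b + k .one + k .c₁ + k .c₂ + k .c₃ := by
  have : (Finset.univ : Finset B5) = {.zero, .a, .x, .b, .one, .c₁, .c₂, .c₃} := rfl
  rw [this]
  simp [Finset.sum_insert, add_assoc]

theorem sizesOfIndex_spec {j : ℕ} (hj : 8 ≤ j) {d} (hd : d ∈ sizeIndices j) :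
    (∀ q, 0 < sizesOfIndex j d q) ∧ ∑ q, sizesOfIndex j d q = j ∧
      sizesOfIndex j d .x ≤ sizesOfIndex j d .c₁ ∧ sizesOfIndex j d .c₂ ≤ sizesOfIndex j d .c₃ := by
  obtain ⟨p, t, i, r, s⟩ := d
  rw [mem_sizeIndices] at hd
  refine ⟨fun q => ?_, ?_, ?_, ?_⟩
  · cases q <;> simp only [sizesOfIndex] <;> omega
  · simp only [B5.sum_eq, sizesOfIndex]
    omega
  · simp only [sizesOfIndex]
    omega
  · simp only [sizesOfIndex]
    omega

theorem sizesOfIndex_injOn {j : ℕ} : Set.InjOn (sizesOfIndex j) (sizeIndices j) := by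
  rintro ⟨p, t, i, r, s⟩ hd ⟨p', t', i', r', s'⟩ hd' he
  rw [Finset.mem_coe, mem_sizeIndices] at hd hd'
  have ha := congrFun he .a
  have hb := congrFun he .b
  have hx := congrFun he .x
  have h2 := congrFun he .c₂
  have h3 := congrFun he .c₃
  simp only [sizesOfIndex] at ha hb hx h2 h3
  obtain rfl : i = i' := ha
  obtain rfl : r = r' := hx
  obtain rfl : s = s' := h2
  obtain rfl : p = p' := by omega
  obtain rfl : t = t' := by omega
  rfl

theorem exists_sizesOfIndex_eq {j : ℕ} {k : B5 → ℕ} (hk : ∀ q, 0 < k q) (hsum : ∑ q, k q = j)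
    (h01 : k .zero = 1 ∧ k .one = 1) (hx : k .x ≤ k .c₁) (hc : k .c₂ ≤ k .c₃) :
    ∃ d ∈ sizeIndices j, sizesOfIndex j d = k := by
  rw [B5.sum_eq] at hsum
  have ha := hk .a
  have hb := hk .b
  have hx' := hk .x
  have hc' := hk .c₂
  -- The `2` accounts for `zero` and `one`. The `- 1` makes `t` the number of ways to write `t + 1`
  -- as an ordered sum of two positive lengths.
  refine ⟨⟨k .c₂ + k .c₃ + 2, k .a + k .b - 1, k .a, k .x, k .c₂⟩, ?_, ?_⟩
  · rw [mem_sizeIndices]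
    omega
  · funext q
    cases q <;> simp only [sizesOfIndex] <;> omega

theorem isBlockB5_iff_exists_hasFibreSizes {α : Type*} [Lattice α] [Finite α] :
    IsBlockB5 α ↔ ∃ k, HasFibreSizes α k := by
  rw [isBlockB5_iff]
  exact ⟨fun ⟨π, h⟩ => ⟨_, π, h, rfl⟩, fun ⟨_, π, h, _⟩ => ⟨π, h⟩⟩

/-- Each index is sent to the class of a lattice with its fibre sizes. Injectivity is uniqueness of
the normalised sizes; surjectivity is normalisation together with the isomorphism of posets having
equal sizes. -/
theorem ncard_blocksB5 {j : ℕ} (hj : 8 ≤ j) : (blocksB5 j).ncard = (sizeIndices j).card := by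
  have hex : ∀ d ∈ sizeIndices j, ∃ L : Lattice (Fin j),
      @HasFibreSizes (Fin j) L.toPartialOrder (sizesOfIndex j d) := by
    intro d hd
    obtain ⟨h1, h2, -⟩ := sizesOfIndex_spec hj hd
    exact exists_lattice_hasFibreSizes h1 (by rw [h2, Nat.card_fin]) rfl rfl
  choose L hL using hex
  rw [← Set.ncard_coe_finset]
  symm
  refine Set.ncard_congr (fun d hd => Quotient.mk (latticeIso j) (L d hd)) ?_ ?_ ?_
  · intro d hd
    exact ⟨L d hd, rfl,
      (@isBlockB5_iff_exists_hasFibreSizes (Fin j) (L d hd) _).2 ⟨_, hL d hd⟩⟩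
  · intro d d' hd hd' he
    obtain ⟨e⟩ := Quotient.exact he
    have h' := @HasFibreSizes.comp_orderIso (Fin j) (L d' hd').toPartialOrder (Fin j)
      (L d hd).toPartialOrder _ (hL d' hd') e
    exact sizesOfIndex_injOn hd hd' (@HasFibreSizes.eq_of_le (Fin j) (L d hd).toPartialOrder _ _ _
      (hL d hd) h' (sizesOfIndex_spec hj hd).2.2 (sizesOfIndex_spec hj hd').2.2)
  · rintro _ ⟨M, rfl, hM⟩
    obtain ⟨k₀, hk₀⟩ := (@isBlockB5_iff_exists_hasFibreSizes (Fin j) M _).1 hM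
    obtain ⟨k, hk, hx, hc⟩ := @HasFibreSizes.exists_normal (Fin j) M.toPartialOrder _ hk₀
    obtain ⟨d, hd, rfl⟩ := exists_sizesOfIndex_eq
      (@HasFibreSizes.pos (Fin j) M.toPartialOrder _ _ hk)
      ((@HasFibreSizes.sum_eq (Fin j) M.toPartialOrder _ _ hk).trans (Nat.card_fin j))
      (@HasFibreSizes.zero_one (Fin j) M.toPartialOrder _ hk) hx hc
    exact ⟨d, hd, Quotient.sound (@HasFibreSizes.nonempty_orderIso (Fin j)
      (L d hd).toPartialOrder _ (Fin j) M.toPartialOrder _ _ (hL d hd) hk)⟩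

end Counting

end RCLattice

theorem mainTheorem10 (j : ℕ) (hj : 8 ≤ j) :
    (RCLattice.blocksB5 j).ncard =
      ∑ p ∈ Finset.Icc 4 (j - 4), ∑ t ∈ Finset.Icc 1 (j - p - 3),
        t * RCLattice.numPartitions (j - p - t - 1) 2 * RCLattice.numPartitions (p - 2) 2 := by
  rw [RCLattice.ncard_blocksB5 hj, RCLattice.card_sizeIndices]
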